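/- **Outage probability of fixed-gain relaying over a mixed RF/FSO link.** *First hop.* Let $1\le m\le N$, $0\le\rho\le1$, and $v,P_1,\sigma_0>0$. Let $\hat h_1,\dots,\hat h_N,w_1,\dots,w_N$ be independent $\mathcal{CN}(0,v)$ variables, and let $h_i=\sqrt{\rho}\,\hat h_i+\sqrt{1-\rho}\,w_i$. Arrange the relays in increasing order of the outdated SNRs $P_1|\hat h_i|^2/\sigma_0^2$, and let $(m)$ be the index of the $m$-th smallest. The first-hop SNR is $\gamma_1=P_1|h_{(m)}|^2/\sigma_0^2$, and $\overline\gamma_1=P_1v/\sigma_0^2$. *Second hop.* Let $I=I_xI_y\,I_l\,I_p$ with $I_l=e^{-\sigma L}$ ($\sigma,L\ge0$) and $I_p=A_0\exp(-2R^2/\omega_{eq}^2)$. Here $I_x,I_y,R$ are independent of each other and of the first hop, and $R$ is Rayleigh with scale $\sigma_s$. The variable $I_x$ is generalized Gamma $GG(\alpha_1,m_1,\Omega_1)$ and $I_y$ is $GG(\alpha_2,m_2,\Omega_2)$, where $GG(\alpha,\mathsf m,\Omega)$ has density $\frac{\alpha x^{\alpha \mathsf m-1}}{\Gamma(\mathsf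 m)}(\mathsf m/\Omega)^{\mathsf m}e^{-\mathsf m x^\alpha/\Omega}$ on $x>0$. All of $A_0,\omega_{eq},\sigma_s,\alpha_i,m_i,\Omega_i$ are positive. For $\eta>0$ and $r\in\{1,2\}$ (heterodyne, IM/DD) let $\gamma_2=(\eta I)^r/\sigma_0^2$, $\mu_r=(\eta\,\mathbb E[I])^r/\sigma_0^2$, and $\xi=\omega_{eq}/(2\sigma_s)$. Suppose $p,q$ are positive integers with $p/q=\alpha_1/\alpha_2$ and $\alpha_2p$ is an integer. *Amplifier.* Let $A,\sigma_r>0$, $a=A^2/\sigma_r^2$, and $G^2=\sigma_r^2/(\mathbb E|h_{(m)}|^2P_1+\sigma_0^2)$. Let $\kappa=1+\sigma_\varsigma^2/(\Omega^2G^2\sigma_0^2)$, where $(\Omega,\sigma_\varsigma^2)$ is one of the following. - Linear: $\Omega=1$, $\sigma_\varsigma^2=0$. - SEL: $\Omega=1-e^{-a}+\frac{\sqrt\pi A}{2\sigma_r}\operatorname{erfc}(A/\sigma_r)$, $\sigma_\varsigma^2=\sigma_r^2(1-e^{-a}-\Omega^2)$. - TWTA: $\Omega=a\,(1+a e^{a}\operatorname{Ei}(-a))$,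 $\sigma_\varsigma^2=-\frac{A^4}{\sigma_r^2}\big[(1+a)e^a\operatorname{Ei}(-a)+1\big]-\sigma_r^2\Omega^2$. The end-to-end SNDR is $\gamma_{e2e}=\dfrac{\gamma_1\gamma_2}{\kappa\gamma_2+\mathbb E[\gamma_1]+\kappa}$. *Claim.* For every $\gamma_{th}>0$, $P_{out}(\gamma_{th})=\Pr[\gamma_{e2e}<\gamma_{th}]$ equals the CDF $F_{\gamma_{e2e}}(\gamma_{th})=\Pr[\gamma_{e2e}\le\gamma_{th}]$ and $$P_{out}(\gamma_{th})=1-\frac{m\,\xi^2p^{m_2-1}q^{m_1-\frac12}r^{\mu-1}}{\sqrt{\alpha_2}\,\Gamma(m_1)\Gamma(m_2)(2\pi)^{\frac{\alpha_2p+r(p+q)-3}{2}}}\binom Nm\sum_{n=0}^{m-1}\binom{m-1}{n}\frac{(-1)^n e^{-\beta_n\kappa\gamma_{th}}}{N-m+n+1}\; G^{0,\;r(p+q+\alpha_2p)+\alpha_2p}_{r(p+q+\alpha_2p)+\alpha_2p,\;r\alpha_2p}\!\left[\Big(\tfrac{\alpha_2p}{\beta_n\gamma_{th}c}\Big)^{\alpha_2p}\big(\zeta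 r^{p+q}\big)^r\,\Big|\,{\kappa_5\atop\kappa_6}\right].$$ Here $G$ is the Meijer G-function and $$\beta_n=\tfrac{N-m+n+1}{[(N-m+n)(1-\rho)+1]\overline\gamma_1},\qquad c=\mathbb E[\gamma_1]+\kappa,$$ $$\zeta=\big(\tfrac{q\Omega_1}{m_1}\big)^q\big(\tfrac{p\Omega_2}{m_2}\big)^p\big(\tfrac{A_0I_l}{\mathbb E[I]}\big)^{\alpha_2p}\mu_r^{\alpha_2p/r}.$$ Write $\Delta(j:x)=\frac xj,\dots,\frac{x+j-1}j$ and $\Delta(r:j:x)=\Delta(r:\frac xj),\dots,\Delta(r:\frac{x+j-1}j)$. Then $$\kappa_5=\Delta(\alpha_2p:1),\ \Delta(r:\alpha_2p:1-\xi^2),\ \Delta(r:q:1-m_1),\ \Delta(r:p:1-m_2),\qquad \kappa_6=\Delta(r:\alpha_2p:-\xi^2),$$ and $\mu=\sum_j\kappa_{2,j}-\sum_j\kappa_{1,j}+\frac{p+q}2+1$, where $\kappa_1=\Delta(\alpha_2p:1-\xi^2),\Delta(q:1-m_1),\Delta(p:1-m_2)$ and $\kappa_2=\Delta(\alpha_2p:-\xi^2)$.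 -/

import Mathlib

open MeasureTheory ProbabilityTheory
open scoped NNReal

noncomputable section

namespace FixedGainRelay

/-! ### Special functions -/

/-- The complementary error function `2 / √π * ∫_x^∞ exp (-t ^ 2) dt`. -/
def erfc (x : ℝ) : ℝ :=
  2 / Real.sqrt Real.pi * ∫ t in Set.Ioi x, Real.exp (-t ^ 2)

/-- `expIntegralNeg a` is `Ei (-a) = -∫_a^∞ exp (-t) / t dt`, for `a > 0`. -/
def expIntegralNeg (a : ℝ) : ℝ :=
  -∫ t in Set.Ioi a, Real.exp (-t) / t

/-- The Mellin–Barnes integrand of the Meijer function `G^{m,n}_{p,q}(z | a ; b)`, where `p` and `q`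
are the lengths of `a` and `b`:
`∏_{j ≤ m} Γ(b_j - s) ∏_{j ≤ n} Γ(1 - a_j + s) / (∏_{j > m} Γ(1 - b_j + s) ∏_{j > n} Γ(a_j - s)) z^s`.
-/
def meijerIntegrand (m n : ℕ) (a b : List ℝ) (z : ℝ) (s : ℂ) : ℂ :=
  (((b.take m).map fun x : ℝ => Complex.Gamma ((x : ℂ) - s)).prod *
      ((a.take n).map fun x : ℝ => Complex.Gamma (1 - (x : ℂ) + s)).prod) /
    (((b.drop m).map fun x : ℝ => Complex.Gamma (1 - (x : ℂ) + s)).prod *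
      ((a.drop n).map fun x : ℝ => Complex.Gamma ((x : ℂ) - s)).prod) * (z : ℂ) ^ s

/-- The vertical line `Re s = σ` has the poles of `Γ(b_j - s)`, `j ≤ m`, on its right and the poles
of `Γ(1 - a_j + s)`, `j ≤ n`, on its left. -/
def SeparatesPoles (m n : ℕ) (a b : List ℝ) (σ : ℝ) : Prop :=
  (∀ x ∈ b.take m, σ < x) ∧ ∀ x ∈ a.take n, x - 1 < σ

open Classical in
/-- The Meijer function `G^{m,n}_{p,q}(z | a ; b) = (2πi)⁻¹ ∫_L …`, for `z > 0`, where `L` is a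
vertical line that separates the two families of poles. The integral converges absolutely whenever
`2 (m + n) > p + q`, and it does not depend on the separating line. -/
def meijerG (m n : ℕ) (a b : List ℝ) (z : ℝ) : ℂ :=
  if h : ∃ σ : ℝ, SeparatesPoles m n a b σ then
    (1 / (2 * Real.pi) : ℂ) *
      ∫ t : ℝ, meijerIntegrand m n a b z ((h.choose : ℂ) + (t : ℂ) * Complex.I)
  else 0

/-- `Δ(j : x) = x / j, (x + 1) / j, …, (x + j - 1) / j`. -/
def delta (j : ℕ) (x : ℝ) : List ℝ :=
  (List.range j).map fun i => (x + i) / j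

/-- `Δ(r : j : x) = Δ(r : x / j), Δ(r : (x + 1) / j), …, Δ(r : (x + j - 1) / j)`. -/
def delta₂ (r j : ℕ) (x : ℝ) : List ℝ :=
  (List.range j).flatMap fun i => delta r ((x + i) / j)

/-! ### Probability laws -/

/-- The circularly symmetric complex Gaussian law `CN(0, v)`: independent real and imaginary parts,
each Gaussian with mean `0` and variance `v / 2`. -/
def complexGaussian (v : ℝ≥0) : Measure ℂ :=
  ((gaussianReal 0 (v / 2)).prod (gaussianReal 0 (v / 2))).map
    fun x => (x.1 : ℂ) + (x.2 : ℂ) * Complex.I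

/-- The generalized Gamma law `GG(α, m, Ω)`: the law of a positive variable whose density is
`α x ^ (α m - 1) (m / Ω) ^ m / Γ(m) * exp (-(m / Ω) x ^ α)`. -/
def genGamma (α m Ω : ℝ) : Measure ℝ :=
  (volume.restrict (Set.Ioi 0)).withDensity fun x =>
    ENNReal.ofReal (α * x ^ (α * m - 1) * (m / Ω) ^ m / Real.Gamma m
      * Real.exp (-(m / Ω) * x ^ α))

/-- The Rayleigh law with scale `s`, of density `x / s ^ 2 * exp (-x ^ 2 / (2 s ^ 2))` on `x > 0`. -/
def rayleigh (s : ℝ) : Measure ℝ :=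
  (volume.restrict (Set.Ioi 0)).withDensity fun x =>
    ENNReal.ofReal (x / s ^ 2 * Real.exp (-x ^ 2 / (2 * s ^ 2)))

/-! ### High power amplifiers -/

/-- The amplifier models: linear (ideal), soft envelope limiter, traveling wave tube. -/
inductive Amplifier
  | linear
  | sel
  | twta

namespace Amplifier

/-- The linear scale `Ω` of the amplifier with input saturation amplitude `A` and mean
input power `σr ^ 2`. -/
def scale (A σr : ℝ) : Amplifier → ℝ
  | linear => 1
  | sel => 1 - Real.exp (-(A ^ 2 / σr ^ 2)) + Real.sqrt Real.pi * A / (2 * σr) * erfc (A / σr)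
  | twta => A ^ 2 / σr ^ 2 *
      (1 + A ^ 2 / σr ^ 2 * Real.exp (A ^ 2 / σr ^ 2) * expIntegralNeg (A ^ 2 / σr ^ 2))

/-- The variance of the non-linear distortion. -/
def distortion (A σr : ℝ) : Amplifier → ℝ
  | linear => 0
  | sel => σr ^ 2 * (1 - Real.exp (-(A ^ 2 / σr ^ 2)) - scale A σr sel ^ 2)
  | twta => -(A ^ 4 / σr ^ 2) *
      ((1 + A ^ 2 / σr ^ 2) * Real.exp (A ^ 2 / σr ^ 2) * expIntegralNeg (A ^ 2 / σr ^ 2) + 1)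
        - σr ^ 2 * scale A σr twta ^ 2

end Amplifier

/-! ### The relaying system -/

/-- The parameters of the dual-hop system, with their ranges. -/
structure System where
  /-- number of relays -/
  N : ℕ
  /-- rank of the selected relay -/
  m : ℕ
  one_le_m : 1 ≤ m
  m_le_N : m ≤ N
  /-- correlation between the outdated and the current channel -/
  ρ : ℝ
  ρ_nonneg : 0 ≤ ρ
  ρ_le_one : ρ ≤ 1
  /-- variance of the first-hop channel gains -/
  v : ℝ≥0
  v_pos : 0 < v
  /-- average power transmitted by the source -/
  P₁ : ℝ
  P₁_pos : 0 < P₁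
  /-- noise standard deviation, so that the noise power is `σ₀ ^ 2` -/
  σ₀ : ℝ
  σ₀_pos : 0 < σ₀
  /-- power amplifier at the relay -/
  amp : Amplifier
  /-- input saturation amplitude of the amplifier -/
  Asat : ℝ
  Asat_pos : 0 < Asat
  /-- root of the mean power at the output of the gain block -/
  σr : ℝ
  σr_pos : 0 < σr
  /-- parameters of the large-scale turbulence `GG(α₁, m₁, Ω₁)` -/
  α₁ : ℝ
  α₁_pos : 0 < α₁
  m₁ : ℝ
  m₁_pos : 0 < m₁
  Ω₁ : ℝ
  Ω₁_pos : 0 < Ω₁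
  /-- parameters of the small-scale turbulence `GG(α₂, m₂, Ω₂)` -/
  α₂ : ℝ
  α₂_pos : 0 < α₂
  m₂ : ℝ
  m₂_pos : 0 < m₂
  Ω₂ : ℝ
  Ω₂_pos : 0 < Ω₂
  /-- weather attenuation -/
  σ : ℝ
  σ_nonneg : 0 ≤ σ
  /-- length of the optical link -/
  L : ℝ
  L_nonneg : 0 ≤ L
  /-- fraction of the power collected in the absence of pointing error -/
  A₀ : ℝ
  A₀_pos : 0 < A₀
  /-- equivalent beam waist -/
  ωeq : ℝ
  ωeq_pos : 0 < ωeq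
  /-- jitter standard deviation -/
  σs : ℝ
  σs_pos : 0 < σs
  /-- electrical-to-optical conversion coefficient -/
  η : ℝ
  η_pos : 0 < η
  /-- detection: `1` is heterodyne, `2` is IM/DD -/
  r : ℕ
  r_eq : r = 1 ∨ r = 2

namespace System

variable (S : System)

/-- Realizations `(ĥ, w, Ix, Iy, R)` of the random inputs: the outdated first-hop gains of the `N`
relays, the Gaussian innovations, the large-scale and the small-scale turbulence, the radial
displacement of the beam. -/
abbrev Sample : Type :=
  (Fin S.N → ℂ) × (Fin S.N → ℂ) × ℝ × ℝ × ℝ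

/-- The joint law of the inputs, which are independent. -/
def law : Measure S.Sample :=
  (Measure.pi fun _ => complexGaussian S.v).prod <|
    (Measure.pi fun _ => complexGaussian S.v).prod <|
      (genGamma S.α₁ S.m₁ S.Ω₁).prod <| (genGamma S.α₂ S.m₂ S.Ω₂).prod <| rayleigh S.σs

/-- The relay of rank `m` when the relays are arranged in increasing order of the SNRs
`P₁ |ĥ_i| ^ 2 / σ₀ ^ 2` that are computed from the outdated gains. -/
def selected (x : S.Sample) : Fin S.N :=
  Tuple.sort (fun i => S.P₁ * ‖x.1 i‖ ^ 2 / S.σ₀ ^ 2)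
    ⟨S.m - 1, by have := S.one_le_m; have := S.m_le_N; omega⟩

/-- The current first-hop gain of the selected relay, `√ρ ĥ + √(1 - ρ) w`. -/
def gain₁ (x : S.Sample) : ℂ :=
  (Real.sqrt S.ρ : ℂ) * x.1 (S.selected x) + (Real.sqrt (1 - S.ρ) : ℂ) * x.2.1 (S.selected x)

/-- The instantaneous SNR of the first hop. -/
def γ₁ (x : S.Sample) : ℝ :=
  S.P₁ * ‖S.gain₁ x‖ ^ 2 / S.σ₀ ^ 2

/-- The average SNR of one first-hop channel. -/
def γbar₁ : ℝ :=
  S.P₁ * S.v / S.σ₀ ^ 2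

/-- The path loss. -/
def pathLoss : ℝ :=
  Real.exp (-S.σ * S.L)

/-- The optical channel gain: turbulence, path loss and pointing error. -/
def gain₂ (x : S.Sample) : ℝ :=
  (x.2.2.1 * x.2.2.2.1) * S.pathLoss *
    (S.A₀ * Real.exp (-(2 * x.2.2.2.2 ^ 2) / S.ωeq ^ 2))

/-- The instantaneous SNR of the optical hop. -/
def γ₂ (x : S.Sample) : ℝ :=
  (S.η * S.gain₂ x) ^ S.r / S.σ₀ ^ 2

/-- The mean optical channel gain. -/
def meanGain₂ : ℝ :=
  ∫ x, S.gain₂ x ∂S.law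

/-- The average electrical SNR. -/
def μr : ℝ :=
  (S.η * S.meanGain₂) ^ S.r / S.σ₀ ^ 2

/-- The mean SNR `E[γ₁]` of the selected first hop. -/
def meanγ₁ : ℝ :=
  ∫ x, S.γ₁ x ∂S.law

/-- The fixed relaying gain. -/
def relayGain : ℝ :=
  Real.sqrt (S.σr ^ 2 / ((∫ x, ‖S.gain₁ x‖ ^ 2 ∂S.law) * S.P₁ + S.σ₀ ^ 2))

/-- The non-linearity factor of the amplifier. -/
def κ : ℝ :=
  1 + S.amp.distortion S.Asat S.σr /
    (S.amp.scale S.Asat S.σr ^ 2 * S.relayGain ^ 2 * S.σ₀ ^ 2)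

/-- The end-to-end signal-to-noise-plus-distortion ratio. -/
def sndr (x : S.Sample) : ℝ :=
  S.γ₁ x * S.γ₂ x / (S.κ * S.γ₂ x + S.meanγ₁ + S.κ)

/-- The outage probability for the threshold `t`. -/
def outage (t : ℝ) : ℝ :=
  S.law.real {x | S.sndr x < t}

/-- The cumulative distribution function of the end-to-end ratio. -/
def sndrCDF (t : ℝ) : ℝ :=
  S.law.real {x | S.sndr x ≤ t}

/-! ### The closed form

`p`, `q` are positive integers with `p / q = α₁ / α₂`, and `k` is the integer `α₂ p`. -/

/-- The pointing error coefficient. -/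
def ξ : ℝ :=
  S.ωeq / (2 * S.σs)

def κ₁ (p q k : ℕ) : List ℝ :=
  delta k (1 - S.ξ ^ 2) ++ delta q (1 - S.m₁) ++ delta p (1 - S.m₂)

def κ₂ (k : ℕ) : List ℝ :=
  delta k (-S.ξ ^ 2)

def κ₅ (p q k : ℕ) : List ℝ :=
  delta k 1 ++ delta₂ S.r k (1 - S.ξ ^ 2) ++ delta₂ S.r q (1 - S.m₁) ++ delta₂ S.r p (1 - S.m₂)

def κ₆ (k : ℕ) : List ℝ :=
  delta₂ S.r k (-S.ξ ^ 2)

def ζ (p q k : ℕ) : ℝ :=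
  (q * S.Ω₁ / S.m₁) ^ q * (p * S.Ω₂ / S.m₂) ^ p *
    (S.A₀ * S.pathLoss / S.meanGain₂) ^ k * S.μr ^ ((k : ℝ) / S.r)

def μ (p q k : ℕ) : ℝ :=
  (S.κ₂ k).sum - (S.κ₁ p q k).sum + ((p : ℝ) + q) / 2 + 1

def β (n : ℕ) : ℝ :=
  ((S.N : ℝ) - S.m + n + 1) / ((((S.N : ℝ) - S.m + n) * (1 - S.ρ) + 1) * S.γbar₁)

def c : ℝ :=
  S.meanγ₁ + S.κ

/-- The factor in front of the sum. -/
def prefactor (p q k : ℕ) : ℝ :=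
  S.m * S.ξ ^ 2 * (p : ℝ) ^ (S.m₂ - 1) * (q : ℝ) ^ (S.m₁ - 1 / 2) *
      (S.r : ℝ) ^ (S.μ p q k - 1) /
    (Real.sqrt S.α₂ * Real.Gamma S.m₁ * Real.Gamma S.m₂ *
      (2 * Real.pi) ^ (((k : ℝ) + S.r * ((p : ℝ) + q) - 3) / 2)) * (S.N.choose S.m : ℝ)

/-- The value at `t` of the Meijer function in the summand of index `n`. -/
def meijerTerm (p q k n : ℕ) (t : ℝ) : ℂ :=
  meijerG 0 (S.r * (p + q + k) + k) (S.κ₅ p q k) (S.κ₆ k)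
    ((k / (S.β n * t * S.c)) ^ k * (S.ζ p q k * (S.r : ℝ) ^ (p + q)) ^ S.r)

end System

end FixedGainRelay

end

namespace FixedGainRelay

/-! ### The Gauss multiplication formula -/

section GaussMultiplication

open Filter Topology Finset

/-! Condition on the optical hop. Where `γ₂ > 0`, the end-to-end ratio exceeds `t` exactly when `γ₁`
exceeds `t (κ + c / γ₂)`, so the outage follows from the tail of `γ₁` and from Laplace-type averages
`E[exp (-y / γ₂)]`.

The tail of `γ₁` is a finite alternating sum of exponentials (`radioLaw_real`). A relay with
outdated gain `z` has rank `m` when exactly `m - 1` of the others lie below it. With `e = exp (-‖z‖²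
/ v)` this has probability `C(N-1, m-1) (1 - e)^(m-1) e^(N-m)`. Expanding the binomial leaves powers
`e^(l-1)`, and such a weight turns `CN(0, v)` into `1/l` times `CN(0, v/l)`. Adding the independent
innovation keeps the gain Gaussian, so its squared norm is exponential, and this gives the rates `β
n`.

For `E[exp (-y / γ₂)]`, write `exp (-u)` as the inverse Mellin transform of `Γ` and exchange the
integrals (`integral_exp_neg_div`). What remains is `Γ(w) y^(-w) E[γ₂^w]`, where the moment is a
product of two Gamma functions divided by `ξ² + r w` (`opticalSNR_moment`). With `w = k s` and `k =
α₂ p = α₁ q`, all Gamma arguments have slopes in `s` that are integers. Gauss's multiplication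
formula (`prod_Gamma_add_div`) then identifies the integrand with that of the Meijer function
(`meijerG_eq_integral_exp`), and the leftover constants cancel against `prefactor`.

Positivity of the denominator of the ratio needs `κ ≥ 1`, that is, nonnegative distortion for each
amplifier. This is a Cauchy–Schwarz inequality, proved through a discriminant. The strict and weak
events have equal probability because the complex Gaussian does not charge circles. -/

theorem prod_range_mul_add (k N : ℕ) (f : ℕ → ℂ) :
    ∏ l ∈ range (k * N), f l = ∏ i ∈ range k, ∏ j ∈ range N, f (k * j + i) := by
  rw [Finset.prod_comm]
  induction N with
  | zero => simp
  | succ N ih => rw [Nat.mul_succ, prod_range_add, ih, prod_range_succ]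

/-- The ratio of `∏ i < k, Γ (s + i / k)` to `Γ (k s)` in Euler's limit formula, up to a power. -/
noncomputable def gaussRatio (k n : ℕ) : ℝ :=
  (n : ℝ) ^ (((k : ℝ) - 1) / 2) * (n.factorial : ℝ) ^ k * (k : ℝ) ^ (k * (n + 1)) /
    ((k * (n + 1) - 1).factorial : ℝ)

theorem sum_range_div_self {k : ℕ} (hk : 0 < k) :
    ∑ i ∈ range k, ((i : ℝ) / k) = ((k : ℝ) - 1) / 2 := by
  have h := Finset.sum_range_id_mul_two k
  have h' : (∑ i ∈ range k, (i : ℝ)) * 2 = k * (k - 1) := by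
    have := congrArg (Nat.cast : ℕ → ℝ) h
    push_cast [Nat.cast_sub (Nat.succ_le_of_lt hk)] at this
    simpa using this
  rw [← sum_div]
  have : (k : ℝ) ≠ 0 := by positivity
  field_simp
  linarith

/-- The denominators of Euler's approximants at `s + i / k` interleave into the single product over
`l < k (n + 1)` of `k s + l`. This is the denominator of the approximant at `k s` of order `k (n +
1) - 1`, since an approximant of order `M` has `M + 1` factors. -/
theorem prod_gammaSeq {k : ℕ} (hk : 0 < k) (s : ℂ) {n : ℕ} (hn : 0 < n) :
    ∏ i ∈ range k, Complex.GammaSeq (s + (i : ℂ) / k) n =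
      ((n : ℝ) / ((k * (n + 1) - 1 : ℕ) : ℝ) : ℝ) ^ ((k : ℂ) * s) * (gaussRatio k n : ℂ) *
        Complex.GammaSeq (k * s) (k * (n + 1) - 1) := by
  have hM : 0 < k * (n + 1) - 1 := by
    have : 2 ≤ k * (n + 1) := by nlinarith
    omega
  have hM1 : k * (n + 1) - 1 + 1 = k * (n + 1) := by omega
  have hk0 : (k : ℂ) ≠ 0 := by exact_mod_cast hk.ne'
  have hn0 : (n : ℂ) ≠ 0 := by exact_mod_cast hn.ne'
  set M := k * (n + 1) - 1 with hMdef
  have hM0 : (M : ℂ) ≠ 0 := by exact_mod_cast hM.ne'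
  have h1 : ∏ i ∈ range k, (n : ℂ) ^ (s + (i : ℂ) / k) =
      (n : ℂ) ^ ((k : ℂ) * s) * (((n : ℝ) ^ (((k : ℝ) - 1) / 2) : ℝ) : ℂ) := by
    rw [← sum_range_div_self hk, Complex.ofReal_cpow (by positivity)]
    push_cast
    rw [← Complex.cpow_add _ _ hn0]
    have : ∀ t : Finset ℕ, ∏ i ∈ t, (n : ℂ) ^ (s + (i : ℂ) / k) =
        (n : ℂ) ^ (∑ i ∈ t, (s + (i : ℂ) / k)) := by
      intro t
      induction t using Finset.induction_on with
      | empty => simp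
      | insert a t ha ih => rw [prod_insert ha, sum_insert ha, Complex.cpow_add (s + (a : ℂ) / k) _ hn0, ih]
    rw [this, sum_add_distrib]
    simp
  have h2 : ∏ l ∈ range (M + 1), ((k : ℂ) * s + l) =
      (k : ℂ) ^ (k * (n + 1)) * ∏ i ∈ range k, ∏ j ∈ range (n + 1), (s + (i : ℂ) / k + j) := by
    rw [hM1, prod_range_mul_add]
    have : ∀ i ∈ range k, ∏ j ∈ range (n + 1), ((k : ℂ) * s + ((k * j + i : ℕ) : ℂ)) =
        (k : ℂ) ^ (n + 1) * ∏ j ∈ range (n + 1), (s + (i : ℂ) / k + j) := by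
      intro i _
      rw [← card_range (n + 1), ← prod_const, card_range, ← prod_mul_distrib]
      refine prod_congr rfl fun j _ => ?_
      push_cast
      field_simp
      ring
    rw [prod_congr rfl this, prod_mul_distrib, prod_const, card_range, ← pow_mul, mul_comm k]
  have h3 : (((n : ℝ) / (M : ℝ) : ℝ) : ℂ) ^ ((k : ℂ) * s) =
      (n : ℂ) ^ ((k : ℂ) * s) / (M : ℂ) ^ ((k : ℂ) * s) := by
    rw [div_eq_mul_inv, Complex.ofReal_mul, Complex.mul_cpow_ofReal_nonneg (by positivity)
      (by positivity), Complex.ofReal_inv, Complex.inv_cpow _ _ (by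
        rw [Complex.ofReal_natCast, Complex.natCast_arg]; exact Real.pi_pos.ne)]
    simp [div_eq_mul_inv]
  have hMs : (M : ℂ) ^ ((k : ℂ) * s) ≠ 0 := by
    simp [Complex.cpow_eq_zero_iff, hM0]
  have hfac : ((M.factorial : ℝ) : ℂ) ≠ 0 := by exact_mod_cast M.factorial_ne_zero
  have hkp : (k : ℂ) ^ (k * (n + 1)) ≠ 0 := pow_ne_zero _ hk0
  simp only [Complex.GammaSeq]
  rw [prod_div_distrib, prod_mul_distrib, h1, h2, h3, prod_const, card_range]
  simp only [gaussRatio, ← hMdef]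
  push_cast at hfac ⊢
  generalize ∏ i ∈ range k, ∏ j ∈ range (n + 1), (s + (i : ℂ) / k + j) = P
  simp only [div_eq_mul_inv, mul_inv]
  generalize P⁻¹ = Q
  field_simp

/-- Both factorials are expressed through Stirling's sequence, which converges to `√π`. After taking
logarithms the identity is linear. -/
theorem gaussRatio_eq {k : ℕ} (hk : 0 < k) {n : ℕ} (hn : 0 < n) :
    gaussRatio k n = ((n : ℝ) / ((n : ℝ) + 1)) ^ (((k : ℝ) - 1) / 2) *
      (Stirling.stirlingSeq (n + 1) ^ k / Stirling.stirlingSeq (k * (n + 1))) *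
        ((2 : ℝ) ^ (((k : ℝ) - 1) / 2) * (k : ℝ) ^ (1 / 2 : ℝ)) := by
  have hs : ∀ j : ℕ, 0 < j → 0 < Stirling.stirlingSeq j := by
    intro j hj
    obtain ⟨i, rfl⟩ := Nat.exists_eq_succ_of_ne_zero hj.ne'
    exact Stirling.stirlingSeq'_pos i
  have hkn : 0 < k * (n + 1) := by positivity
  have hk' : (0 : ℝ) < k := by exact_mod_cast hk
  have hn' : (0 : ℝ) < n := by exact_mod_cast hn
  have a1 := hs (n + 1) (by omega)
  have a2 := hs _ hkn
  have f1 : (0 : ℝ) < n.factorial := by positivity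
  have f2 : (0 : ℝ) < (k * (n + 1) - 1).factorial := by positivity
  have e1 : Real.log ((n + 1).factorial : ℝ) = Real.log ((n : ℝ) + 1) + Real.log (n.factorial) := by
    rw [Nat.factorial_succ]; push_cast; rw [Real.log_mul (by positivity) (by positivity)]
  have e2 : Real.log ((k * (n + 1)).factorial : ℝ) =
      Real.log k + Real.log ((n : ℝ) + 1) + Real.log ((k * (n + 1) - 1).factorial) := by
    rw [← Nat.mul_factorial_pred hkn.ne']
    push_cast
    rw [Real.log_mul (by positivity) (by positivity), Real.log_mul (by positivity) (by positivity)]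
  apply Real.log_injOn_pos
  · simp only [gaussRatio, Set.mem_Ioi]; positivity
  · simp only [Set.mem_Ioi]; positivity
  rw [gaussRatio]
  simp (disch := positivity) only [Real.log_mul, Real.log_div, Real.log_rpow, Real.log_pow,
    Stirling.log_stirlingSeq_formula, e1, e2, Nat.cast_mul, Nat.cast_add, Nat.cast_one,
    Real.log_exp]
  ring

theorem tendsto_gaussRatio {k : ℕ} (hk : 0 < k) :
    Tendsto (gaussRatio k) atTop
      (𝓝 ((2 * Real.pi) ^ (((k : ℝ) - 1) / 2) * (k : ℝ) ^ (1 / 2 : ℝ))) := by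
  have h1 : Tendsto (fun n : ℕ => (n : ℝ) / ((n : ℝ) + 1)) atTop (𝓝 1) :=
    tendsto_natCast_div_add_atTop 1
  have h2 := Stirling.tendsto_stirlingSeq_sqrt_pi.comp (tendsto_add_atTop_nat 1)
  have h3 : Tendsto (fun n : ℕ => k * (n + 1)) atTop atTop :=
    (tendsto_add_atTop_nat 1).const_mul_atTop' hk
  have h4 := Stirling.tendsto_stirlingSeq_sqrt_pi.comp h3
  have hpi : 0 < Real.sqrt Real.pi := Real.sqrt_pos.2 Real.pi_pos
  have h := ((h1.rpow_const (p := ((k : ℝ) - 1) / 2) (Or.inl one_ne_zero)).mul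
    ((h2.pow k).div h4 hpi.ne')).mul_const
      ((2 : ℝ) ^ (((k : ℝ) - 1) / 2) * (k : ℝ) ^ (1 / 2 : ℝ))
  have hc : (1 : ℝ) ^ (((k : ℝ) - 1) / 2) * (Real.sqrt Real.pi ^ k / Real.sqrt Real.pi) *
      ((2 : ℝ) ^ (((k : ℝ) - 1) / 2) * (k : ℝ) ^ (1 / 2 : ℝ)) =
      (2 * Real.pi) ^ (((k : ℝ) - 1) / 2) * (k : ℝ) ^ (1 / 2 : ℝ) := by
    have : Real.sqrt Real.pi ^ k / Real.sqrt Real.pi = Real.pi ^ (((k : ℝ) - 1) / 2) := by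
      rw [← Real.rpow_natCast, ← Real.rpow_sub_one hpi.ne', Real.sqrt_eq_rpow,
        ← Real.rpow_mul Real.pi_pos.le]
      congr 1; ring
    rw [this, Real.one_rpow, Real.mul_rpow (by norm_num) Real.pi_pos.le]
    ring
  rw [hc] at h
  refine h.congr' ?_
  filter_upwards [eventually_gt_atTop 0] with n hn
  exact (gaussRatio_eq hk hn).symm

/-- Gauss's multiplication formula, as the limit of `prod_gammaSeq`. The factor `k ^ (-k s)` is the
limit of the powers of `n / (k (n + 1) - 1)`. -/
theorem prod_Gamma_add_div {k : ℕ} (hk : 0 < k) (s : ℂ) :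
    ∏ i ∈ range k, Complex.Gamma (s + (i : ℂ) / k) =
      ((2 * Real.pi : ℝ) : ℂ) ^ (((k : ℂ) - 1) / 2) * (k : ℂ) ^ (1 / 2 - (k : ℂ) * s) *
        Complex.Gamma (k * s) := by
  have hk0 : (k : ℂ) ≠ 0 := by exact_mod_cast hk.ne'
  have hk' : (0 : ℝ) < k := by exact_mod_cast hk
  have h1 : Tendsto (fun n => ∏ i ∈ range k, Complex.GammaSeq (s + (i : ℂ) / k) n) atTop
      (𝓝 (∏ i ∈ range k, Complex.Gamma (s + (i : ℂ) / k))) :=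
    tendsto_finsetProd _ fun i _ => Complex.GammaSeq_tendsto_Gamma _
  have hM : Tendsto (fun n : ℕ => k * (n + 1) - 1) atTop atTop := by
    refine tendsto_atTop_mono (fun n => ?_) tendsto_id
    have : n + 1 ≤ k * (n + 1) := Nat.le_mul_of_pos_left _ hk
    simp only [id]; omega
  have h2 : Tendsto (fun n : ℕ => (n : ℝ) / ((k * (n + 1) - 1 : ℕ) : ℝ)) atTop (𝓝 (k : ℝ)⁻¹) := by
    have : Tendsto (fun n : ℕ => (k : ℝ) + ((k : ℝ) - 1) / n) atTop (𝓝 ((k : ℝ) + 0)) :=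
      tendsto_const_nhds.add (tendsto_const_div_atTop_nhds_zero_nat _)
    rw [add_zero] at this
    refine (this.inv₀ hk'.ne').congr' ?_
    filter_upwards [eventually_gt_atTop 0] with n hn
    have hn' : (n : ℝ) ≠ 0 := by exact_mod_cast hn.ne'
    rw [Nat.cast_sub (Nat.succ_le_of_lt (by positivity))]
    push_cast
    rw [inv_eq_one_div, show (k : ℝ) + ((k : ℝ) - 1) / n = (k * (n + 1) - 1) / n by
      field_simp; ring, one_div_div]
  have h3 : Tendsto (fun n : ℕ => (((n : ℝ) / ((k * (n + 1) - 1 : ℕ) : ℝ) : ℝ) : ℂ) ^ ((k : ℂ) * s))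
      atTop (𝓝 ((((k : ℝ)⁻¹ : ℝ) : ℂ) ^ ((k : ℂ) * s))) := by
    refine ((Complex.continuousAt_ofReal_cpow_const _ _ (Or.inr (by positivity))).tendsto).comp h2
  have h4 := (h3.mul ((Complex.continuous_ofReal.tendsto _).comp (tendsto_gaussRatio hk))).mul
    ((Complex.GammaSeq_tendsto_Gamma (k * s)).comp hM)
  have h5 := tendsto_nhds_unique (h1.congr' (by
    filter_upwards [eventually_gt_atTop 0] with n hn using prod_gammaSeq hk s hn)) h4
  rw [h5]
  congr 1
  rw [Complex.ofReal_mul, Complex.ofReal_cpow (by positivity), Complex.ofReal_cpow (by positivity),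
    Complex.cpow_sub _ _ hk0, Complex.ofReal_inv, Complex.inv_cpow _ _ (by
        rw [Complex.ofReal_natCast, Complex.natCast_arg]; exact Real.pi_pos.ne)]
  push_cast
  ring

end GaussMultiplication

/-! ### Products of Gamma functions over the lists `Δ` -/

section Delta

open Finset

/-- Powers are turned into exponentials throughout, so that an identity between constants becomes a
linear identity between logarithms. -/
theorem ofReal_cpow_eq_exp {x : ℝ} (hx : 0 < x) (s : ℂ) :
    (x : ℂ) ^ s = Complex.exp (Real.log x * s) := by
  rw [Complex.cpow_def_of_ne_zero (by exact_mod_cast hx.ne'), Complex.ofReal_log hx.le]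

theorem natCast_cpow_eq_exp {n : ℕ} (hn : 0 < n) (s : ℂ) :
    (n : ℂ) ^ s = Complex.exp (Real.log n * s) := by
  rw [← Complex.ofReal_natCast, ofReal_cpow_eq_exp (by exact_mod_cast hn)]

theorem delta_eq_map (j : ℕ) (x : ℝ) :
    delta j x = (List.range j).map fun i : ℕ => (x + (i : ℝ)) / j := by
  simp only [delta, List.bind_eq_flatMap, List.pure_def, List.map_flatMap, List.map_cons, List.map_nil]
  exact List.map_eq_flatMap.symm

theorem delta₂_eq_flatMap (r j : ℕ) (x : ℝ) :
    delta₂ r j x = (List.range j).flatMap fun i : ℕ => delta r ((x + (i : ℝ)) / j) := by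
  simp [delta₂, List.flatMap_assoc]

theorem list_prod_range {M : Type*} [CommMonoid M] (f : ℕ → M) (j : ℕ) :
    ((List.range j).map f).prod = ∏ i ∈ range j, f i := by
  rw [Finset.prod, ← Multiset.prod_coe]; rfl

theorem prod_map_delta (j : ℕ) (x : ℝ) (f : ℝ → ℂ) :
    ((delta j x).map f).prod = ∏ i ∈ range j, f ((x + i) / j) := by
  rw [delta_eq_map, List.map_map, list_prod_range]; rfl

theorem sum_delta (j : ℕ) (x : ℝ) : (delta j x).sum = ∑ i ∈ range j, (x + i) / j := by
  rw [delta_eq_map, Finset.sum, ← Multiset.sum_coe]; rfl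

theorem prod_map_delta₂ (r j : ℕ) (x : ℝ) (f : ℝ → ℂ) :
    ((delta₂ r j x).map f).prod =
      ∏ i ∈ range j, ((delta r ((x + i) / j)).map f).prod := by
  rw [delta₂_eq_flatMap, ← list_prod_range, List.map_flatMap, List.flatMap, List.prod_flatten,
    List.map_map]
  rfl

theorem length_delta (j : ℕ) (x : ℝ) : (delta j x).length = j := by
  simp [delta_eq_map]

theorem length_delta₂ (r j : ℕ) (x : ℝ) : (delta₂ r j x).length = j * r := by
  simp [delta₂_eq_flatMap, length_delta]

theorem prod_Gamma_delta {j : ℕ} (hj : 0 < j) (x : ℝ) (s : ℂ) :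
    ((delta j x).map fun a : ℝ => Complex.Gamma (1 - (a : ℂ) + s)).prod =
      Complex.exp (Real.log (2 * Real.pi) * ((j - 1) / 2) +
        Real.log j * (x - 1 / 2 - j * s)) * Complex.Gamma (j * s + 1 - x) := by
  have hj0 : (j : ℂ) ≠ 0 := by exact_mod_cast hj.ne'
  have h := prod_Gamma_add_div hj ((j * s + 1 - x) / j)
  rw [mul_div_cancel₀ _ hj0, natCast_cpow_eq_exp hj, ofReal_cpow_eq_exp (by positivity),
    ← Complex.exp_add] at h
  -- The list is traversed backwards: `1 - (x + i) / j + s` equals `(j s + 1 - x) / j + (j - 1 - i)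
  -- / j`.
  rw [prod_map_delta, ← Finset.prod_range_reflect]
  convert h using 1
  · refine prod_congr rfl fun i hi => ?_
    have hi := mem_range.1 hi
    congr 1
    rw [show j - 1 - i = j - (i + 1) by omega]
    push_cast [Nat.cast_sub (show i + 1 ≤ j by omega)]
    field_simp
    ring
  · congr 2
    ring

/-- Gauss's formula twice: each inner list collapses to one Gamma function of `r s`, and these again
form a product over `Δ(j : x)`. The inner constants add up to `(delta j x).sum`, which is where the
exponent `μ` comes from. -/
theorem prod_Gamma_delta₂ {r j : ℕ} (hr : 0 < r) (hj : 0 < j) (x : ℝ) (s : ℂ) :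
    ((delta₂ r j x).map fun a : ℝ => Complex.Gamma (1 - (a : ℂ) + s)).prod =
      Complex.exp (Real.log (2 * Real.pi) * ((j * r - 1) / 2) +
        Real.log r * ((delta j x).sum - j / 2 - j * r * s) +
        Real.log j * (x - 1 / 2 - j * r * s)) * Complex.Gamma (j * r * s + 1 - x) := by
  rw [prod_map_delta₂]
  simp_rw [prod_Gamma_delta hr]
  have h := prod_Gamma_delta hj x (r * s)
  rw [prod_map_delta] at h
  rw [prod_mul_distrib, ← Complex.exp_sum]
  have h' : ∏ i ∈ range j, Complex.Gamma (r * s + 1 - (((x + i) / j : ℝ) : ℂ)) =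
      ∏ i ∈ range j, Complex.Gamma (1 - (((x + i) / j : ℝ) : ℂ) + r * s) := by
    refine prod_congr rfl fun i _ => ?_
    congr 1; ring
  rw [h', h, ← mul_assoc, ← Complex.exp_add, sum_delta]
  congr 2
  · rw [sum_add_distrib, ← mul_sum, ← mul_sum, sum_sub_distrib, sum_sub_distrib]
    push_cast
    simp only [sum_const, card_range, nsmul_eq_mul]
    ring
  · ring

end Delta

/-! ### The Meijer integrand as an elementary product of Gamma functions. -/

namespace System

variable (S : System)

theorem r_pos : 0 < S.r := by
  rcases S.r_eq with h | h <;> omega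

theorem ξ_pos : 0 < S.ξ := div_pos S.ωeq_pos (mul_pos two_pos S.σs_pos)

theorem length_κ₅ (p q k : ℕ) : (S.κ₅ p q k).length = S.r * (p + q + k) + k := by
  simp only [κ₅, List.length_append, length_delta, length_delta₂]
  ring

theorem sum_delta_sub {k : ℕ} (hk : 0 < k) (x : ℝ) :
    (delta k (1 + x)).sum = (delta k x).sum + 1 := by
  have hk0 : (k : ℝ) ≠ 0 := by exact_mod_cast hk.ne'
  have : (delta k (1 + x)).sum - (delta k x).sum = 1 := by
    rw [sum_delta, sum_delta, ← Finset.sum_sub_distrib]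
    have : ∀ i ∈ Finset.range k, (1 + x + (i : ℝ)) / k - (x + i) / k = 1 / k := by
      intro i _; ring
    rw [Finset.sum_congr rfl this]
    simp [hk0]
  linarith

/-- Every entry of `κ₅` is at most `1`, and `1` occurs. The contour chosen inside `meijerG` is
therefore an unspecified line in the right half plane, and positivity of its abscissa is all that
can be used. -/
theorem separatesPoles_iff {p q k : ℕ} (hp : 0 < p) (hq : 0 < q) (hk : 0 < k) (σ : ℝ) :
    SeparatesPoles 0 (S.r * (p + q + k) + k) (S.κ₅ p q k) (S.κ₆ k) σ ↔ 0 < σ := by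
  have hr := S.r_pos
  have key : ∀ (j : ℕ) (x : ℝ), 0 < j → x ≤ 1 → ∀ y ∈ delta j x, y ≤ 1 := by
    intro j x hj hx y hy
    rw [delta_eq_map] at hy
    obtain ⟨i, hi, rfl⟩ := List.mem_map.1 hy
    have hi : (i : ℝ) + 1 ≤ j := by exact_mod_cast List.mem_range.1 hi
    have hj' : (0 : ℝ) < j := by exact_mod_cast hj
    rw [div_le_one hj']
    linarith
  have key₂ : ∀ (j : ℕ) (x : ℝ), 0 < j → x ≤ 1 → ∀ y ∈ delta₂ S.r j x, y ≤ 1 := by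
    intro j x hj hx y hy
    rw [delta₂_eq_flatMap] at hy
    obtain ⟨i, hi, hy⟩ := List.mem_flatMap.1 hy
    exact key _ _ hr (key j x hj hx _ (by rw [delta_eq_map]; exact List.mem_map.2 ⟨i, hi, rfl⟩)) _ hy
  have hξ := sq_nonneg S.ξ
  rw [SeparatesPoles, ← S.length_κ₅ p q k, List.take_length]
  constructor
  · rintro ⟨-, h⟩
    -- The last entry of `Δ(k : 1)` is `(1 + (k - 1)) / k = 1`.
    have := h 1 (by
      simp only [κ₅, List.mem_append, delta_eq_map k 1]
      refine Or.inl (Or.inl (Or.inl (List.mem_map.2 ⟨k - 1, List.mem_range.2 (by omega), ?_⟩)))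
      rw [Nat.cast_sub (by omega)]
      have hk0 : (k : ℝ) ≠ 0 := by exact_mod_cast hk.ne'
      push_cast
      field_simp
      ring)
    linarith
  · intro hσ
    refine ⟨by simp, fun x hx => ?_⟩
    suffices x ≤ 1 by linarith
    simp only [κ₅, List.mem_append] at hx
    rcases hx with ((hx | hx) | hx) | hx
    · exact key _ _ hk le_rfl _ hx
    · exact key₂ _ _ hk (by linarith) _ hx
    · exact key₂ _ _ hq (by linarith [S.m₁_pos]) _ hx
    · exact key₂ _ _ hp (by linarith [S.m₂_pos]) _ hx

/-- The lists `Δ` collapse by Gauss's formula. The pointing-error lists of `κ₅` and `κ₆` differ by a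
unit shift, so they leave `Γ(d) / Γ(d + 1) = 1 / d` with `d = ξ² + k r s`. -/
theorem meijerIntegrand_eq {p q k : ℕ} (hp : 0 < p) (hq : 0 < q) (hk : 0 < k) {y z : ℝ}
    (hy : 0 < y) (hz : 0 < z) {s : ℂ} (hs : 0 < s.re) :
    meijerIntegrand 0 (S.r * (p + q + k) + k) (S.κ₅ p q k) (S.κ₆ k)
        ((k / y) ^ k * (z * (S.r : ℝ) ^ (p + q)) ^ S.r) s =
      Complex.exp (Real.log (2 * Real.pi) * ((k + S.r * ((p : ℝ) + q) - 3) / 2) +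
        Real.log S.r * (1 - S.μ p q k) + Real.log k * (3 / 2) +
        Real.log q * (1 / 2 - S.m₁ - q * S.r * s) +
        Real.log p * (1 / 2 - S.m₂ - p * S.r * s) - Real.log y * (k * s) +
        Real.log z * (S.r * s)) *
      (Complex.Gamma (k * s) * Complex.Gamma (S.m₁ + q * S.r * s) *
        Complex.Gamma (S.m₂ + p * S.r * s) / (S.ξ ^ 2 + k * S.r * s)) := by
  have hr := S.r_pos
  have hk' : (0 : ℝ) < k := by exact_mod_cast hk
  have hr' : (0 : ℝ) < S.r := by exact_mod_cast hr
  have hre : ((k : ℂ) * S.r * s).re = k * S.r * s.re := by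
    rw [← Complex.ofReal_natCast, ← Complex.ofReal_natCast, ← Complex.ofReal_mul,
      Complex.re_ofReal_mul]
  have hξ : 0 < S.ξ ^ 2 := by have := S.ξ_pos; positivity
  have hpos : 0 < ((S.ξ : ℂ) ^ 2 + k * S.r * s).re := by
    rw [Complex.add_re, hre, ← Complex.ofReal_pow, Complex.ofReal_re]
    positivity
  have hne : (S.ξ : ℂ) ^ 2 + k * S.r * s ≠ 0 := fun h => by simp [h] at hpos
  have hG := Complex.Gamma_ne_zero_of_re_pos hpos
  have hlog : Real.log ((k / y) ^ k * (z * (S.r : ℝ) ^ (p + q)) ^ S.r) =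
      k * (Real.log k - Real.log y) + S.r * (Real.log z + (p + q) * Real.log S.r) := by
    rw [Real.log_mul (by positivity) (by positivity), Real.log_pow, Real.log_pow,
      Real.log_div (by positivity) (by positivity), Real.log_mul (by positivity) (by positivity),
      Real.log_pow]
    push_cast
    ring
  rw [meijerIntegrand, ← S.length_κ₅ p q k, List.take_length, List.drop_length,
    ofReal_cpow_eq_exp (by positivity), hlog]
  simp only [List.take_zero, List.drop_zero, List.map_nil, List.prod_nil, one_mul, mul_one]
  simp only [κ₅, κ₆, List.map_append, List.prod_append, prod_Gamma_delta hk,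
    prod_Gamma_delta₂ hr hk, prod_Gamma_delta₂ hr hq, prod_Gamma_delta₂ hr hp]
  have e1 : (k : ℂ) * S.r * s + 1 - ((1 - S.ξ ^ 2 : ℝ) : ℂ) = (S.ξ : ℂ) ^ 2 + k * S.r * s := by
    push_cast; ring
  have e2 : (k : ℂ) * S.r * s + 1 - ((-S.ξ ^ 2 : ℝ) : ℂ) = (S.ξ : ℂ) ^ 2 + k * S.r * s + 1 := by
    push_cast; ring
  have e3 : (q : ℂ) * S.r * s + 1 - ((1 - S.m₁ : ℝ) : ℂ) = S.m₁ + q * S.r * s := by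
    push_cast; ring
  have e4 : (p : ℂ) * S.r * s + 1 - ((1 - S.m₂ : ℝ) : ℂ) = S.m₂ + p * S.r * s := by
    push_cast; ring
  have e5 : (k : ℂ) * s + 1 - ((1 : ℝ) : ℂ) = k * s := by push_cast; ring
  rw [e1, e2, e3, e4, e5, Complex.Gamma_add_one _ hne]
  have hsum := sum_delta_sub hk (-S.ξ ^ 2)
  rw [← sub_eq_add_neg] at hsum
  have hμ : S.μ p q k = -1 - (delta q (1 - S.m₁)).sum - (delta p (1 - S.m₂)).sum +
      ((p : ℝ) + q) / 2 + 1 := by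
    simp only [μ, κ₁, κ₂, List.sum_append, hsum]
    ring
  rw [hμ, hsum]
  generalize Complex.Gamma (S.ξ ^ 2 + k * S.r * s) = g at hG
  generalize Complex.Gamma (k * s) = g₁
  generalize Complex.Gamma (S.m₁ + q * S.r * s) = g₂
  generalize Complex.Gamma (S.m₂ + p * S.r * s) = g₃
  generalize (S.ξ : ℂ) ^ 2 + k * S.r * s = d at hne
  -- Only the exponents remain to be compared; the Gamma factors are treated as opaque.
  have key : ∀ a₁ a₂ a₃ a₄ a₅ a₆ a₇ : ℂ, a₁ + a₂ + a₃ + a₄ + a₅ = a₇ + a₆ →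
      Complex.exp a₁ * g₁ * (Complex.exp a₂ * g) * (Complex.exp a₃ * g₂) * (Complex.exp a₄ * g₃) /
        (Complex.exp a₆ * (d * g)) * Complex.exp a₅ =
      Complex.exp a₇ * (g₁ * g₂ * g₃ / d) := by
    intro a₁ a₂ a₃ a₄ a₅ a₆ a₇ h
    have h' := congrArg Complex.exp h
    simp only [Complex.exp_add] at h'
    have := Complex.exp_ne_zero a₆
    field_simp
    linear_combination (g₁ * g₂ * g₃) * h'
  refine key _ _ _ _ _ _ _ ?_
  push_cast
  ring

end System

/-! ### Moments of the generalized Gamma and Rayleigh laws -/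

section Moments

open Set

/-- The law on `(0, ∞)` of density `g`. -/
noncomputable def halfLineLaw (g : ℝ → ℝ) : Measure ℝ :=
  (volume.restrict (Ioi 0)).withDensity fun x => ENNReal.ofReal (g x)

theorem halfLineLaw_integrable_iff {g : ℝ → ℝ} (hg : Measurable g) (hg0 : ∀ x, 0 < x → 0 ≤ g x)
    (f : ℝ → ℂ) :
    Integrable f (halfLineLaw g) ↔ IntegrableOn (fun x => (g x : ℂ) * f x) (Ioi 0) := by
  rw [halfLineLaw, integrable_withDensity_iff_integrable_smul' hg.ennreal_ofReal
    (Filter.Eventually.of_forall fun _ => ENNReal.ofReal_lt_top)]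
  refine integrable_congr ?_
  filter_upwards [ae_restrict_mem measurableSet_Ioi] with x hx
  rw [ENNReal.toReal_ofReal (hg0 x hx), Complex.real_smul]

theorem integral_halfLineLaw {g : ℝ → ℝ} (hg : Measurable g) (hg0 : ∀ x, 0 < x → 0 ≤ g x)
    (f : ℝ → ℂ) :
    ∫ x, f x ∂(halfLineLaw g) = ∫ x in Ioi 0, (g x : ℂ) * f x := by
  rw [halfLineLaw, integral_withDensity_eq_integral_toReal_smul hg.ennreal_ofReal
    (Filter.Eventually.of_forall fun _ => ENNReal.ofReal_lt_top)]
  refine integral_congr_ae ?_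
  filter_upwards [ae_restrict_mem measurableSet_Ioi] with x hx
  rw [ENNReal.toReal_ofReal (hg0 x hx), Complex.real_smul]

theorem halfLineLaw_ae_pos (g : ℝ → ℝ) : ∀ᵐ x ∂(halfLineLaw g), 0 < x :=
  withDensity_absolutelyContinuous _ _ (ae_restrict_mem measurableSet_Ioi)

theorem isProbabilityMeasure_halfLineLaw {g : ℝ → ℝ}
    (hi : Integrable (fun _ => (1 : ℂ)) (halfLineLaw g))
    (h1 : ∫ _, (1 : ℂ) ∂(halfLineLaw g) = 1) : IsProbabilityMeasure (halfLineLaw g) := by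
  have hfin : IsFiniteMeasure (halfLineLaw g) := by
    rcases integrable_const_iff.1 hi with h | h
    · simp at h
    · exact h
  rw [integral_const, Complex.real_smul, mul_one] at h1
  have h2 : (halfLineLaw g).real univ = 1 := by exact_mod_cast h1
  rw [measureReal_def, ENNReal.toReal_eq_one_iff] at h2
  exact ⟨h2⟩

/-- The density of the generalized Gamma law. -/
noncomputable def genGammaDensity (α m Ω x : ℝ) : ℝ :=
  α * x ^ (α * m - 1) * (m / Ω) ^ m / Real.Gamma m * Real.exp (-(m / Ω) * x ^ α)

theorem genGamma_eq (α m Ω : ℝ) : genGamma α m Ω = halfLineLaw (genGammaDensity α m Ω) := rfl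

section GenGamma

variable {α m Ω : ℝ}

theorem measurable_genGammaDensity : Measurable (genGammaDensity α m Ω) := by
  unfold genGammaDensity; fun_prop

theorem genGammaDensity_nonneg (hα : 0 < α) (hm : 0 < m) (hΩ : 0 < Ω) (x : ℝ) (hx : 0 < x) :
    0 ≤ genGammaDensity α m Ω x := by
  have := Real.Gamma_pos_of_pos hm
  unfold genGammaDensity
  positivity

theorem genGammaDensity_mul_cpow (z : ℂ) {x : ℝ} (hx : 0 < x) :
    (genGammaDensity α m Ω x : ℂ) * (x : ℂ) ^ z =
      ((α * (m / Ω) ^ m / Real.Gamma m : ℝ) : ℂ) * ((x : ℂ) ^ (α * m + z - 1) *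
        (Real.exp (-((m / Ω) * x ^ α)) : ℝ)) := by
  rw [show (α : ℂ) * m + z - 1 = ((α * m - 1 : ℝ) : ℂ) + z by push_cast; ring,
    Complex.cpow_add _ _ (by exact_mod_cast hx.ne'), ← Complex.ofReal_cpow hx.le, genGammaDensity,
    neg_mul]
  push_cast
  ring

/-- The substitution `u = (m / Ω) x ^ α` reduces the integral to Euler's integral for `Γ(m + z /
α)`. -/
theorem genGamma_mellin (hα : 0 < α) (hm : 0 < m) (hΩ : 0 < Ω) {z : ℂ} (hz : 0 < α * m + z.re) :
    MellinConvergent (fun x : ℝ => ((Real.exp (-((m / Ω) * x ^ α)) : ℝ) : ℂ)) (α * m + z) ∧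
    mellin (fun x : ℝ => ((Real.exp (-((m / Ω) * x ^ α)) : ℝ) : ℂ)) (α * m + z) =
      (α : ℂ)⁻¹ * (((m / Ω : ℝ) : ℂ) ^ (-(m + z / α)) * Complex.Gamma (m + z / α)) := by
  have hα0 : (α : ℂ) ≠ 0 := by exact_mod_cast hα.ne'
  have hdiv : ((α : ℂ) * m + z) / α = m + z / α := by field_simp
  have hb : 0 < m / Ω := by positivity
  have hre : 0 < ((m : ℂ) + z / α).re := by
    rw [← hdiv, Complex.div_ofReal_re]
    refine div_pos ?_ hα
    rw [← Complex.ofReal_mul, Complex.add_re, Complex.ofReal_re]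
    exact hz
  have hconv : MellinConvergent (fun x : ℝ => ((Real.exp (-x) : ℝ) : ℂ)) (m + z / α) := by
    have h := Complex.GammaIntegral_convergent hre
    refine h.congr_fun (fun x _ => ?_) measurableSet_Ioi
    simp [mul_comm]
  have h1 : MellinConvergent (fun x : ℝ => ((Real.exp (-((m / Ω) * x)) : ℝ) : ℂ)) (m + z / α) :=
    (MellinConvergent.comp_mul_left (f := fun x : ℝ => ((Real.exp (-x) : ℝ) : ℂ)) hb).2 hconv
  constructor
  · exact (MellinConvergent.comp_rpow
      (f := fun x : ℝ => ((Real.exp (-((m / Ω) * x)) : ℝ) : ℂ)) hα.ne').2 (by rwa [hdiv])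
  · rw [mellin_comp_rpow (fun x : ℝ => ((Real.exp (-((m / Ω) * x)) : ℝ) : ℂ)), hdiv, abs_of_pos hα,
      mellin_comp_mul_left (fun x : ℝ => ((Real.exp (-x) : ℝ) : ℂ)) _ hb,
      Complex.Gamma_eq_integral hre, Complex.GammaIntegral_eq_mellin, Complex.real_smul, smul_eq_mul]
    push_cast
    rfl

theorem integrable_genGamma_cpow (hα : 0 < α) (hm : 0 < m) (hΩ : 0 < Ω) {z : ℂ}
    (hz : 0 < α * m + z.re) : Integrable (fun x : ℝ => (x : ℂ) ^ z) (genGamma α m Ω) := by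
  rw [genGamma_eq, halfLineLaw_integrable_iff measurable_genGammaDensity
    (genGammaDensity_nonneg hα hm hΩ)]
  have h := (genGamma_mellin hα hm hΩ hz).1
  refine IntegrableOn.congr_fun (f := fun x : ℝ => _) (h.const_mul _)
    (fun x hx => (genGammaDensity_mul_cpow z hx).symm) measurableSet_Ioi

theorem integral_genGamma_cpow (hα : 0 < α) (hm : 0 < m) (hΩ : 0 < Ω) {z : ℂ}
    (hz : 0 < α * m + z.re) :
    ∫ x : ℝ, (x : ℂ) ^ z ∂(genGamma α m Ω) =
      Complex.exp (Real.log (Ω / m) * (z / α)) * Complex.Gamma (m + z / α) / Real.Gamma m := by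
  have hb : 0 < m / Ω := by positivity
  have hα0 : (α : ℂ) ≠ 0 := by exact_mod_cast hα.ne'
  rw [genGamma_eq, integral_halfLineLaw measurable_genGammaDensity
    (genGammaDensity_nonneg hα hm hΩ),
    setIntegral_congr_fun measurableSet_Ioi fun x hx => genGammaDensity_mul_cpow z hx,
    integral_const_mul]
  have h := (genGamma_mellin hα hm hΩ hz).2
  rw [mellin] at h
  simp only [smul_eq_mul] at h
  rw [h, neg_add, Complex.cpow_add _ _ (by exact_mod_cast hb.ne'), Complex.cpow_neg]
  have hlog : Real.log (Ω / m) = -Real.log (m / Ω) := by rw [← Real.log_inv, inv_div]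
  rw [ofReal_cpow_eq_exp hb (-(z / α)), hlog]
  push_cast [Complex.ofReal_cpow hb.le]
  have hne : ((m / Ω : ℝ) : ℂ) ^ (m : ℂ) ≠ 0 := by
    rw [ofReal_cpow_eq_exp hb]; exact Complex.exp_ne_zero _
  push_cast at hne
  rw [neg_mul, mul_neg]
  field_simp

theorem isProbabilityMeasure_genGamma (hα : 0 < α) (hm : 0 < m) (hΩ : 0 < Ω) :
    IsProbabilityMeasure (genGamma α m Ω) := by
  have hz : 0 < α * m + (0 : ℂ).re := by simp; positivity
  have h := integrable_genGamma_cpow hα hm hΩ hz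
  have h' := integral_genGamma_cpow hα hm hΩ hz
  have := (Real.Gamma_pos_of_pos hm).ne'
  simp only [Complex.cpow_zero, zero_div, mul_zero, add_zero, Complex.exp_zero, one_mul,
    Complex.Gamma_ofReal] at h h'
  rw [div_self (by exact_mod_cast this)] at h'
  exact isProbabilityMeasure_halfLineLaw h h'

end GenGamma

theorem rayleigh_eq (s : ℝ) :
    rayleigh s = halfLineLaw fun x => x / s ^ 2 * Real.exp (-x ^ 2 / (2 * s ^ 2)) := rfl

/-- The integrand is a multiple of `x exp (-b x²)` with `b = 1 / (2 s²) + z`, whose integral is `1 /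
(2 b)`. The pointing loss enters the moments through this formula. -/
theorem rayleigh_exp_integral {s : ℝ} (hs : 0 < s) {z : ℂ} (hz : 0 ≤ z.re) :
    Integrable (fun x : ℝ => Complex.exp (-(z * (x : ℂ) ^ 2))) (rayleigh s) ∧
    ∫ x : ℝ, Complex.exp (-(z * (x : ℂ) ^ 2)) ∂(rayleigh s) = 1 / (1 + 2 * s ^ 2 * z) := by
  have hs0 : (s : ℂ) ≠ 0 := by exact_mod_cast hs.ne'
  have hg : Measurable fun x : ℝ => x / s ^ 2 * Real.exp (-x ^ 2 / (2 * s ^ 2)) := by fun_prop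
  have hg0 : ∀ x : ℝ, 0 < x → 0 ≤ x / s ^ 2 * Real.exp (-x ^ 2 / (2 * s ^ 2)) := by
    intro x hx; positivity
  have hbre : 0 < (((1 / (2 * s ^ 2) : ℝ) : ℂ) + z).re := by
    rw [Complex.add_re, Complex.ofReal_re]; positivity
  have hfun : ∀ x : ℝ, ((x / s ^ 2 * Real.exp (-x ^ 2 / (2 * s ^ 2)) : ℝ) : ℂ) *
      Complex.exp (-(z * (x : ℂ) ^ 2)) =
      1 / (s : ℂ) ^ 2 * ((x : ℂ) * Complex.exp (-(((1 / (2 * s ^ 2) : ℝ) : ℂ) + z) * (x : ℂ) ^ 2)) := by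
    intro x
    push_cast
    rw [show -(1 / (2 * (s : ℂ) ^ 2) + z) * (x : ℂ) ^ 2 =
      -(x : ℂ) ^ 2 / (2 * (s : ℂ) ^ 2) + -(z * (x : ℂ) ^ 2) by ring, Complex.exp_add]
    ring
  rw [rayleigh_eq, halfLineLaw_integrable_iff hg hg0, integral_halfLineLaw hg hg0]
  simp_rw [hfun]
  refine ⟨((integrable_mul_cexp_neg_mul_sq hbre).const_mul _).integrableOn, ?_⟩
  rw [integral_const_mul, integral_mul_cexp_neg_mul_sq hbre]
  push_cast
  rw [one_div_mul_eq_div, ← one_div, div_div]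
  congr 1
  field_simp

theorem isProbabilityMeasure_rayleigh {s : ℝ} (hs : 0 < s) : IsProbabilityMeasure (rayleigh s) := by
  have h := rayleigh_exp_integral hs (z := 0) (by simp)
  simp only [zero_mul, neg_zero, Complex.exp_zero, mul_zero, add_zero, div_one] at h
  exact isProbabilityMeasure_halfLineLaw h.1 h.2

end Moments

/-! ### A Mellin–Barnes representation of `E[exp (-y / X)]` -/

section MellinBarnes

open Set

/-- From `Γ(s + 2) = (s + 1) s Γ(s)` and `‖Γ(s + 2)‖ ≤ Γ(σ + 2)`. Quadratic decay is enough for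
integrability on the line. -/
theorem norm_Gamma_vertical_le {σ : ℝ} (hσ : 0 < σ) (t : ℝ) :
    ‖Complex.Gamma (σ + t * Complex.I)‖ ≤ Real.Gamma (σ + 2) / min (σ ^ 2) 1 * (1 + t ^ 2)⁻¹ := by
  set s : ℂ := σ + t * Complex.I with hs
  have hre : s.re = σ := by simp [hs]
  have him : s.im = t := by simp [hs]
  have hs0 : s ≠ 0 := fun h => by rw [h] at hre; simp at hre; linarith
  have hs1 : s + 1 ≠ 0 := fun h => by
    have := congrArg Complex.re h; simp [hre] at this; linarith
  have h2 : Complex.Gamma (s + 1 + 1) = (s + 1) * (s * Complex.Gamma s) := by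
    rw [Complex.Gamma_add_one _ hs1, Complex.Gamma_add_one _ hs0]
  have hle : ‖Complex.Gamma (s + 1 + 1)‖ ≤ Real.Gamma (σ + 2) := by
    have hpos : 0 < (s + 1 + 1).re := by simp [hre]; linarith
    rw [Complex.Gamma_eq_integral hpos, Real.Gamma_eq_integral (by linarith),
      Complex.GammaIntegral]
    refine (norm_integral_le_integral_norm _).trans (le_of_eq ?_)
    refine setIntegral_congr_fun measurableSet_Ioi fun x hx => ?_
    simp only [norm_mul]
    rw [Complex.norm_cpow_eq_rpow_re_of_pos hx, Complex.norm_real, Real.norm_of_nonneg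
      (Real.exp_pos _).le]
    simp only [Complex.sub_re, Complex.add_re, hre, Complex.one_re]
    ring_nf
  have hnorm : min (σ ^ 2) 1 * (1 + t ^ 2) ≤ ‖s + 1‖ * ‖s‖ := by
    have a1 : ‖s‖ ^ 2 = σ ^ 2 + t ^ 2 := by
      rw [Complex.sq_norm, Complex.normSq_apply, hre, him]; ring
    have a2 : ‖s + 1‖ ^ 2 = (σ + 1) ^ 2 + t ^ 2 := by
      rw [Complex.sq_norm, Complex.normSq_apply]; simp [hre, him]; ring
    have a3 : ‖s‖ ≤ ‖s + 1‖ := by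
      apply le_of_sq_le_sq _ (norm_nonneg _); nlinarith
    have a4 : ‖s‖ ^ 2 ≤ ‖s + 1‖ * ‖s‖ := by
      rw [sq]; exact mul_le_mul_of_nonneg_right a3 (norm_nonneg _)
    have a5 := min_le_left (σ ^ 2) 1
    have a6 := min_le_right (σ ^ 2) 1
    nlinarith [sq_nonneg t]
  have hmin : 0 < min (σ ^ 2) 1 := by positivity
  rw [h2, norm_mul, norm_mul, ← mul_assoc] at hle
  rw [← div_eq_mul_inv, div_div, le_div_iff₀ (by positivity), mul_comm]
  exact (mul_le_mul_of_nonneg_right hnorm (norm_nonneg _)).trans hle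

theorem continuous_Gamma_vertical {σ : ℝ} (hσ : 0 < σ) :
    Continuous fun t : ℝ => Complex.Gamma (σ + t * Complex.I) := by
  refine continuous_iff_continuousAt.2 fun t => ?_
  have hd : ContinuousAt Complex.Gamma (σ + t * Complex.I) := by
    refine (Complex.differentiableAt_Gamma _ fun m h => ?_).continuousAt
    have := congrArg Complex.re h
    simp at this
    have : (0 : ℝ) ≤ m := by positivity
    linarith
  exact ContinuousAt.comp (f := fun t : ℝ => (σ : ℂ) + t * Complex.I) hd (by fun_prop)

theorem integrable_Gamma_vertical {σ : ℝ} (hσ : 0 < σ) :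
    Integrable fun t : ℝ => Complex.Gamma (σ + t * Complex.I) :=
  (integrable_inv_one_add_sq.const_mul _).mono'
    (continuous_Gamma_vertical hσ).aestronglyMeasurable
    (Filter.Eventually.of_forall (norm_Gamma_vertical_le hσ))

theorem exp_neg_eq_integral_Gamma {σ u : ℝ} (hσ : 0 < σ) (hu : 0 < u) :
    ((Real.exp (-u) : ℝ) : ℂ) = 1 / (2 * Real.pi) *
      ∫ t : ℝ, Complex.exp (-(Real.log u * (σ + t * Complex.I))) *
        Complex.Gamma (σ + t * Complex.I) := by
  have hre : ∀ t : ℝ, 0 < ((σ : ℂ) + t * Complex.I).re := by intro t; simpa using hσ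
  have hconv : MellinConvergent (fun x : ℝ => ((Real.exp (-x) : ℝ) : ℂ)) σ := by
    have h := Complex.GammaIntegral_convergent (s := σ) (by simpa using hσ)
    refine h.congr_fun (fun x _ => ?_) measurableSet_Ioi
    simp [mul_comm]
  have hM : ∀ t : ℝ, mellin (fun x : ℝ => ((Real.exp (-x) : ℝ) : ℂ)) (σ + t * Complex.I) =
      Complex.Gamma (σ + t * Complex.I) := by
    intro t
    rw [Complex.Gamma_eq_integral (hre t), Complex.GammaIntegral_eq_mellin]
  have hvert : Complex.VerticalIntegrable
      (mellin (fun x : ℝ => ((Real.exp (-x) : ℝ) : ℂ))) σ := by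
    simp only [Complex.VerticalIntegrable, hM]
    exact integrable_Gamma_vertical hσ
  have h := mellinInv_mellin_eq σ (fun x : ℝ => ((Real.exp (-x) : ℝ) : ℂ)) hu hconv hvert
    (by fun_prop)
  rw [← h, mellinInv]
  simp only [hM, smul_eq_mul, Complex.real_smul]
  push_cast
  congr 2
  ext t
  rw [ofReal_cpow_eq_exp hu]
  congr 2
  ring

/-- The Mellin inversion of `exp (-u)` is applied at `u = y / X` and averaged. -/
theorem integral_exp_neg_div {Θ : Type*} [MeasurableSpace Θ] {P : Measure Θ} [SFinite P]
    {X : Θ → ℝ} (hX : Measurable X) (hpos : ∀ᵐ x ∂P, 0 < X x) {σ y : ℝ} (hσ : 0 < σ) (hy : 0 < y)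
    (hint : Integrable (fun x => (X x : ℂ) ^ (σ : ℂ)) P) :
    ((∫ x, Real.exp (-(y / X x)) ∂P : ℝ) : ℂ) = 1 / (2 * Real.pi) *
      ∫ t : ℝ, Complex.Gamma (σ + t * Complex.I) *
        Complex.exp (-(Real.log y * (σ + t * Complex.I))) *
          ∫ x, (X x : ℂ) ^ (σ + t * Complex.I) ∂P := by
  set F : Θ → ℝ → ℂ := fun x t => Complex.Gamma (σ + t * Complex.I) *
    Complex.exp (-(Real.log y * (σ + t * Complex.I))) *
      Complex.exp (Real.log (X x) * (σ + t * Complex.I)) with hF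
  have hF1 : ∀ᵐ x ∂P, ((Real.exp (-(y / X x)) : ℝ) : ℂ) = 1 / (2 * Real.pi) * ∫ t, F x t := by
    filter_upwards [hpos] with x hx
    rw [exp_neg_eq_integral_Gamma hσ (div_pos hy hx)]
    congr 2
    ext t
    rw [Real.log_div hy.ne' hx.ne']
    simp only [hF]
    rw [mul_comm, mul_assoc, ← Complex.exp_add]
    congr 2
    push_cast
    ring
  have hGm : Measurable fun t : ℝ => Complex.Gamma (σ + t * Complex.I) :=
    (continuous_Gamma_vertical hσ).measurable
  have hmeas : Measurable (Function.uncurry F) := by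
    simp only [hF, Function.uncurry_def]
    have h1 : Measurable fun p : Θ × ℝ => Complex.Gamma (σ + p.2 * Complex.I) :=
      hGm.comp measurable_snd
    have h2 : Measurable fun p : Θ × ℝ => Real.log (X p.1) :=
      Real.measurable_log.comp (hX.comp measurable_fst)
    fun_prop
  have hFint : Integrable (Function.uncurry F) (P.prod volume) := by
    -- On the line `Re s = σ` one has `‖X ^ s‖ = X ^ σ`, so the integrand is dominated by a product
    -- of a function of `x` and a function of `t`, both integrable.
    have hI := (hint.mul_prod
      ((integrable_Gamma_vertical hσ).norm.const_mul (Real.exp (-(Real.log y * σ))) |>.ofReal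
        (𝕜 := ℂ)))
    refine hI.mono hmeas.aestronglyMeasurable ?_
    have hpos' : ∀ᵐ p ∂(P.prod (volume : Measure ℝ)), 0 < X p.1 :=
      Measure.quasiMeasurePreserving_fst.ae hpos
    filter_upwards [hpos'] with p hp
    simp only [Function.uncurry_def, hF, norm_mul, Complex.norm_exp, RCLike.norm_ofReal,
      abs_mul, abs_norm, Real.abs_exp]
    rw [Complex.norm_cpow_eq_rpow_re_of_pos hp, Real.rpow_def_of_pos hp]
    simp
    refine le_of_eq ?_
    ring
  rw [← integral_complex_ofReal, integral_congr_ae hF1, integral_const_mul,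
    integral_integral_swap hFint]
  congr 2
  ext t
  rw [← integral_const_mul]
  refine integral_congr_ae ?_
  filter_upwards [hpos] with x hx
  simp only [hF]
  rw [ofReal_cpow_eq_exp hx]

end MellinBarnes

namespace System

variable (S : System)

/-! ### The optical hop -/

/-- The joint law of the turbulence components and of the radial displacement. -/
noncomputable def opticalLaw : Measure (ℝ × ℝ × ℝ) :=
  (genGamma S.α₁ S.m₁ S.Ω₁).prod <| (genGamma S.α₂ S.m₂ S.Ω₂).prod <| rayleigh S.σs

/-- The optical channel gain, as a function of the inputs of the optical hop. -/
noncomputable def opticalGain (y : ℝ × ℝ × ℝ) : ℝ :=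
  (y.1 * y.2.1) * S.pathLoss * (S.A₀ * Real.exp (-(2 * y.2.2 ^ 2) / S.ωeq ^ 2))

/-- The SNR of the optical hop, as a function of its inputs. -/
noncomputable def opticalSNR (y : ℝ × ℝ × ℝ) : ℝ :=
  (S.η * S.opticalGain y) ^ S.r / S.σ₀ ^ 2

instance : IsProbabilityMeasure (genGamma S.α₁ S.m₁ S.Ω₁) :=
  isProbabilityMeasure_genGamma S.α₁_pos S.m₁_pos S.Ω₁_pos

instance : IsProbabilityMeasure (genGamma S.α₂ S.m₂ S.Ω₂) :=
  isProbabilityMeasure_genGamma S.α₂_pos S.m₂_pos S.Ω₂_pos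

instance : IsProbabilityMeasure (rayleigh S.σs) :=
  isProbabilityMeasure_rayleigh S.σs_pos

instance : IsProbabilityMeasure S.opticalLaw := by
  unfold opticalLaw; infer_instance

theorem measurable_opticalGain : Measurable S.opticalGain := by
  unfold opticalGain; fun_prop

theorem measurable_opticalSNR : Measurable S.opticalSNR := by
  have := S.measurable_opticalGain
  unfold opticalSNR; fun_prop

theorem pathLoss_pos : 0 < S.pathLoss := Real.exp_pos _

theorem opticalLaw_ae_pos : ∀ᵐ y ∂S.opticalLaw, 0 < y.1 ∧ 0 < y.2.1 := by
  have h1 : ∀ᵐ y ∂S.opticalLaw, 0 < y.1 :=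
    Measure.quasiMeasurePreserving_fst.ae (halfLineLaw_ae_pos _)
  have h2 : ∀ᵐ y ∂S.opticalLaw, 0 < y.2.1 :=
    Measure.quasiMeasurePreserving_snd.ae
      (Measure.quasiMeasurePreserving_fst.ae (halfLineLaw_ae_pos _))
  exact h1.and h2

theorem opticalGain_ae_pos : ∀ᵐ y ∂S.opticalLaw, 0 < S.opticalGain y := by
  filter_upwards [S.opticalLaw_ae_pos] with y hy
  have := S.pathLoss_pos
  have := S.A₀_pos
  obtain ⟨h1, h2⟩ := hy
  unfold opticalGain
  positivity

theorem opticalSNR_ae_pos : ∀ᵐ y ∂S.opticalLaw, 0 < S.opticalSNR y := by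
  filter_upwards [S.opticalGain_ae_pos] with y hy
  have := S.η_pos
  have := S.σ₀_pos
  unfold opticalSNR
  positivity

theorem opticalGain_cpow {y : ℝ × ℝ × ℝ} (hy : 0 < y.1 ∧ 0 < y.2.1) (z : ℂ) :
    (S.opticalGain y : ℂ) ^ z = ((y.1 : ℂ) ^ z * ((y.2.1 : ℂ) ^ z *
      Complex.exp (-((2 * z / S.ωeq ^ 2) * (y.2.2 : ℂ) ^ 2)))) *
      Complex.exp (Real.log (S.A₀ * S.pathLoss) * z) := by
  have h1 := S.pathLoss_pos
  have h2 := S.A₀_pos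
  obtain ⟨h3, h4⟩ := hy
  rw [ofReal_cpow_eq_exp h3, ofReal_cpow_eq_exp h4, ofReal_cpow_eq_exp (by
    unfold opticalGain; positivity), ← Complex.exp_add, ← Complex.exp_add, ← Complex.exp_add]
  congr 1
  unfold opticalGain
  rw [Real.log_mul (by positivity) (by positivity), Real.log_mul (by positivity) (by positivity),
    Real.log_mul (by positivity) (by positivity), Real.log_mul (by positivity) (by positivity),
    Real.log_mul (by positivity) (by positivity), Real.log_exp]
  push_cast
  ring

/-- By independence the moment factors into two generalized Gamma moments and one Rayleigh
exponential moment. -/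
theorem opticalGain_moment {z : ℂ} (hz : 0 ≤ z.re) :
    Integrable (fun y => (S.opticalGain y : ℂ) ^ z) S.opticalLaw ∧
    ∫ y, (S.opticalGain y : ℂ) ^ z ∂S.opticalLaw =
      Complex.exp (Real.log (S.Ω₁ / S.m₁) * (z / S.α₁) + Real.log (S.Ω₂ / S.m₂) * (z / S.α₂) +
        Real.log (S.A₀ * S.pathLoss) * z) *
      (Complex.Gamma (S.m₁ + z / S.α₁) * Complex.Gamma (S.m₂ + z / S.α₂) / (S.ξ ^ 2 + z)) *
        (S.ξ ^ 2 / (Real.Gamma S.m₁ * Real.Gamma S.m₂)) := by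
  have hω := S.ωeq_pos
  have hs := S.σs_pos
  have hm1 : 0 < S.α₁ * S.m₁ + z.re :=
    add_pos_of_pos_of_nonneg (mul_pos S.α₁_pos S.m₁_pos) hz
  have hm2 : 0 < S.α₂ * S.m₂ + z.re :=
    add_pos_of_pos_of_nonneg (mul_pos S.α₂_pos S.m₂_pos) hz
  have hz' : 0 ≤ (2 * z / (S.ωeq : ℂ) ^ 2).re := by
    rw [← Complex.ofReal_pow, Complex.div_ofReal_re]
    have : (2 * z).re = 2 * z.re := by simp
    rw [this]; positivity
  obtain ⟨hR1, hR2⟩ := rayleigh_exp_integral hs hz'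
  have hae : (fun y => (S.opticalGain y : ℂ) ^ z) =ᵐ[S.opticalLaw]
      fun y => ((y.1 : ℂ) ^ z * ((y.2.1 : ℂ) ^ z *
      Complex.exp (-((2 * z / S.ωeq ^ 2) * (y.2.2 : ℂ) ^ 2)))) *
      Complex.exp (Real.log (S.A₀ * S.pathLoss) * z) := by
    filter_upwards [S.opticalLaw_ae_pos] with y hy using S.opticalGain_cpow hy z
  constructor
  · refine Integrable.congr ?_ hae.symm
    exact ((integrable_genGamma_cpow S.α₁_pos S.m₁_pos S.Ω₁_pos hm1).mul_prod
      ((integrable_genGamma_cpow S.α₂_pos S.m₂_pos S.Ω₂_pos hm2).mul_prod hR1)).mul_const _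
  · rw [integral_congr_ae hae, integral_mul_const, opticalLaw,
      integral_prod_mul (fun x : ℝ => (x : ℂ) ^ z) (fun w : ℝ × ℝ => (w.1 : ℂ) ^ z *
        Complex.exp (-((2 * z / S.ωeq ^ 2) * (w.2 : ℂ) ^ 2))),
      integral_prod_mul (fun x : ℝ => (x : ℂ) ^ z) (fun x : ℝ =>
        Complex.exp (-((2 * z / S.ωeq ^ 2) * (x : ℂ) ^ 2))),
      integral_genGamma_cpow S.α₁_pos S.m₁_pos S.Ω₁_pos hm1,
      integral_genGamma_cpow S.α₂_pos S.m₂_pos S.Ω₂_pos hm2, hR2, Complex.exp_add, Complex.exp_add]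
    have hξ : (0 : ℝ) < S.ξ ^ 2 := pow_pos S.ξ_pos 2
    have hne : (S.ξ : ℂ) ^ 2 + z ≠ 0 := fun h => by
      have := congrArg Complex.re h
      rw [Complex.add_re, ← Complex.ofReal_pow, Complex.ofReal_re, Complex.zero_re] at this
      linarith
    have hξ0 : (S.ξ : ℂ) ^ 2 ≠ 0 := by exact_mod_cast hξ.ne'
    have hω0 : (S.ωeq : ℂ) ≠ 0 := by exact_mod_cast hω.ne'
    have hs0 : (S.σs : ℂ) ≠ 0 := by exact_mod_cast hs.ne'
    -- Since `ξ = ωeq / (2 σs)`, the denominator on the left is `1 + z / ξ²`.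
    have e : 1 / (1 + 2 * (S.σs : ℂ) ^ 2 * (2 * z / (S.ωeq : ℂ) ^ 2)) =
        (S.ξ : ℂ) ^ 2 / ((S.ξ : ℂ) ^ 2 + z) := by
      have : 1 + 2 * (S.σs : ℂ) ^ 2 * (2 * z / (S.ωeq : ℂ) ^ 2) =
          ((S.ξ : ℂ) ^ 2 + z) / (S.ξ : ℂ) ^ 2 := by
        rw [ξ]; push_cast; field_simp
      rw [this, one_div_div]
    rw [e]
    ring


theorem opticalSNR_cpow {y : ℝ × ℝ × ℝ} (hy : 0 < S.opticalGain y) (w : ℂ) :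
    (S.opticalSNR y : ℂ) ^ w = Complex.exp ((S.r * Real.log S.η - 2 * Real.log S.σ₀) * w) *
      (S.opticalGain y : ℂ) ^ (S.r * w) := by
  have h1 := S.η_pos
  have h2 := S.σ₀_pos
  rw [ofReal_cpow_eq_exp hy, ofReal_cpow_eq_exp (by unfold opticalSNR; positivity),
    ← Complex.exp_add]
  congr 1
  unfold opticalSNR
  rw [Real.log_div (by positivity) (by positivity), Real.log_pow, Real.log_pow,
    Real.log_mul (by positivity) (by positivity)]
  push_cast
  ring

theorem opticalSNR_moment {w : ℂ} (hw : 0 ≤ w.re) :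
    Integrable (fun y => (S.opticalSNR y : ℂ) ^ w) S.opticalLaw ∧
    ∫ y, (S.opticalSNR y : ℂ) ^ w ∂S.opticalLaw =
      Complex.exp (Real.log (S.Ω₁ / S.m₁) * (S.r * w / S.α₁) +
        Real.log (S.Ω₂ / S.m₂) * (S.r * w / S.α₂) +
        Real.log (S.A₀ * S.pathLoss) * (S.r * w) +
        (S.r * Real.log S.η - 2 * Real.log S.σ₀) * w) *
      (Complex.Gamma (S.m₁ + S.r * w / S.α₁) * Complex.Gamma (S.m₂ + S.r * w / S.α₂) /
        (S.ξ ^ 2 + S.r * w)) * (S.ξ ^ 2 / (Real.Gamma S.m₁ * Real.Gamma S.m₂)) := by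
  have hre : ((S.r : ℂ) * w).re = S.r * w.re := by
    rw [← Complex.ofReal_natCast, Complex.re_ofReal_mul]
  obtain ⟨h1, h2⟩ := S.opticalGain_moment (z := S.r * w) (by rw [hre]; positivity)
  have hae : (fun y => (S.opticalSNR y : ℂ) ^ w) =ᵐ[S.opticalLaw] fun y =>
      Complex.exp ((S.r * Real.log S.η - 2 * Real.log S.σ₀) * w) *
        (S.opticalGain y : ℂ) ^ (S.r * w) := by
    filter_upwards [S.opticalGain_ae_pos] with y hy using S.opticalSNR_cpow hy w
  refine ⟨(h1.const_mul _).congr hae.symm, ?_⟩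
  rw [integral_congr_ae hae, integral_const_mul, h2, Complex.exp_add _
    ((S.r * Real.log S.η - 2 * Real.log S.σ₀) * w)]
  ring

theorem integrable_opticalGain : Integrable S.opticalGain S.opticalLaw := by
  have h := (S.opticalGain_moment (z := 1) (by simp)).1
  simp only [Complex.cpow_one] at h
  simpa using h.re

theorem integral_opticalGain_pos : 0 < ∫ y, S.opticalGain y ∂S.opticalLaw := by
  have h0 : 0 ≤ᵐ[S.opticalLaw] S.opticalGain := by
    filter_upwards [S.opticalGain_ae_pos] with y hy using hy.le
  refine (integral_nonneg_of_ae h0).lt_of_ne' fun h => ?_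
  rw [integral_eq_zero_iff_of_nonneg_ae h0 S.integrable_opticalGain] at h
  obtain ⟨y, h1, h2⟩ := (h.and S.opticalGain_ae_pos).exists
  exact h2.ne' h1

/-- The factor between the Meijer function and the Laplace transform of `1 / γ₂`. -/
noncomputable def meijerFactor (p q k : ℕ) : ℝ :=
  Real.exp (Real.log (2 * Real.pi) * ((k + S.r * ((p : ℝ) + q) - 3) / 2) +
    Real.log S.r * (1 - S.μ p q k) + Real.log k * (1 / 2) + Real.log q * (1 / 2 - S.m₁) +
    Real.log p * (1 / 2 - S.m₂)) * (Real.Gamma S.m₁ * Real.Gamma S.m₂ / S.ξ ^ 2)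

/-- The hypotheses on `p`, `q`, `k` give `k = α₁ q = α₂ p`, so at `w = k s` the Gamma arguments of
the moment become `m₁ + q r s` and `m₂ + p r s`. -/
theorem meijerIntegrand_eq_moment {p q k : ℕ} (hp : 0 < p) (hq : 0 < q) (hk0 : 0 < k)
    (hpq : (p : ℝ) / q = S.α₁ / S.α₂) (hk : (k : ℝ) = S.α₂ * p) (hmean : 0 < S.meanGain₂)
    {y : ℝ} (hy : 0 < y) {s : ℂ} (hs : 0 < s.re) :
    meijerIntegrand 0 (S.r * (p + q + k) + k) (S.κ₅ p q k) (S.κ₆ k)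
        ((k / y) ^ k * (S.ζ p q k * (S.r : ℝ) ^ (p + q)) ^ S.r) s =
      S.meijerFactor p q k * k * (Complex.Gamma (k * s) * Complex.exp (-(Real.log y * (k * s))) *
        ∫ x, (S.opticalSNR x : ℂ) ^ (k * s) ∂S.opticalLaw) := by
  have hm1 := S.m₁_pos
  have hm2 := S.m₂_pos
  have hO1 := S.Ω₁_pos
  have hO2 := S.Ω₂_pos
  have hA := S.A₀_pos
  have hL := S.pathLoss_pos
  have ha1 := S.α₁_pos
  have ha2 := S.α₂_pos
  have hη := S.η_pos
  have hσ := S.σ₀_pos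
  have hr := S.r_pos
  have hμr : 0 < S.μr := by unfold μr; positivity
  have hp' : (0 : ℝ) < p := by exact_mod_cast hp
  have hq' : (0 : ℝ) < q := by exact_mod_cast hq
  have hk' : (0 : ℝ) < k := by exact_mod_cast hk0
  have hr' : (0 : ℝ) < S.r := by exact_mod_cast hr
  have hζ : 0 < S.ζ p q k := by unfold ζ; positivity
  have hk1 : (k : ℝ) = S.α₁ * q := by
    rw [div_eq_div_iff hq'.ne' ha2.ne'] at hpq; linarith
  -- The mean gain cancels: `ζ` contains its power `-k` explicitly and its power `k` through `μr ^
  -- (k / r)`.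
  have hlogζ : Real.log (S.ζ p q k) = q * (Real.log q + Real.log (S.Ω₁ / S.m₁)) +
      p * (Real.log p + Real.log (S.Ω₂ / S.m₂)) +
      k * (Real.log (S.A₀ * S.pathLoss) + Real.log S.η) - 2 * Real.log S.σ₀ * (k / S.r) := by
    have e1 : Real.log S.μr = S.r * (Real.log S.η + Real.log S.meanGain₂) - 2 * Real.log S.σ₀ := by
      rw [μr, Real.log_div (by positivity) (by positivity), Real.log_pow, Real.log_pow,
        Real.log_mul hη.ne' hmean.ne']
      push_cast; ring
    rw [ζ, mul_div_assoc, mul_div_assoc, Real.log_mul (by positivity) (by positivity),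
      Real.log_mul (by positivity) (by positivity), Real.log_mul (by positivity) (by positivity),
      Real.log_pow, Real.log_pow, Real.log_pow, Real.log_rpow hμr, e1,
      Real.log_div (by positivity) hmean.ne',
      Real.log_mul (x := (q : ℝ)) (by positivity) (by positivity),
      Real.log_mul (x := (p : ℝ)) (by positivity) (by positivity)]
    field_simp
    ring
  have hks : 0 ≤ ((k : ℂ) * s).re := by
    rw [← Complex.ofReal_natCast, Complex.re_ofReal_mul]; positivity
  have hd1 : (S.r : ℂ) * (k * s) / S.α₁ = q * S.r * s := by
    have : (S.α₁ : ℂ) ≠ 0 := by exact_mod_cast ha1.ne'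
    rw [← Complex.ofReal_natCast k, hk1]
    push_cast
    field_simp
  have hd2 : (S.r : ℂ) * (k * s) / S.α₂ = p * S.r * s := by
    have : (S.α₂ : ℂ) ≠ 0 := by exact_mod_cast ha2.ne'
    rw [← Complex.ofReal_natCast k, hk]
    push_cast
    field_simp
  have hd3 : (S.r : ℂ) * (k * s) = k * S.r * s := by ring
  rw [S.meijerIntegrand_eq hp hq hk0 hy hζ hs, (S.opticalSNR_moment hks).2, hd1, hd2, hd3, hlogζ,
    meijerFactor]
  have hξ0 : (S.ξ : ℂ) ≠ 0 := by exact_mod_cast S.ξ_pos.ne'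
  have hG1 : (Real.Gamma S.m₁ : ℂ) ≠ 0 := by exact_mod_cast (Real.Gamma_pos_of_pos hm1).ne'
  have hG2 : (Real.Gamma S.m₂ : ℂ) ≠ 0 := by exact_mod_cast (Real.Gamma_pos_of_pos hm2).ne'
  have hkexp : (k : ℂ) = Complex.exp (Real.log k) := by
    rw [← Complex.ofReal_exp, Real.exp_log hk']; simp
  have hr0 : (S.r : ℂ) ≠ 0 := by exact_mod_cast hr.ne'
  generalize Complex.Gamma (k * s) = g₁
  generalize Complex.Gamma (S.m₁ + q * S.r * s) = g₂
  generalize Complex.Gamma (S.m₂ + p * S.r * s) = g₃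
  generalize (S.ξ : ℂ) ^ 2 + k * S.r * s = d
  push_cast
  have key : ∀ a₁ a₂ a₃ a₄ : ℂ, a₄ = a₁ + Real.log k + a₂ + a₃ →
      Complex.exp a₄ * (g₁ * g₂ * g₃ / d) =
      Complex.exp a₁ * ((Real.Gamma S.m₁ : ℂ) * Real.Gamma S.m₂ / (S.ξ : ℂ) ^ 2) * k *
        (g₁ * Complex.exp a₂ * (Complex.exp a₃ * (g₂ * g₃ / d) *
          ((S.ξ : ℂ) ^ 2 / (Real.Gamma S.m₁ * Real.Gamma S.m₂)))) := by
    intro a₁ a₂ a₃ a₄ h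
    rw [h, Complex.exp_add, Complex.exp_add, Complex.exp_add, ← hkexp]
    field_simp
  refine key _ _ _ _ ?_
  push_cast
  field_simp
  ring

/-- The change of variable `u = k t` carries the line `Re s = σ` to `Re w = k σ`. Its Jacobian
absorbs the extra factor `k` in `meijerIntegrand_eq_moment`. -/
theorem meijerG_eq_integral_exp {p q k : ℕ} (hp : 0 < p) (hq : 0 < q) (hk0 : 0 < k)
    (hpq : (p : ℝ) / q = S.α₁ / S.α₂) (hk : (k : ℝ) = S.α₂ * p) (hmean : 0 < S.meanGain₂)
    {y : ℝ} (hy : 0 < y) :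
    meijerG 0 (S.r * (p + q + k) + k) (S.κ₅ p q k) (S.κ₆ k)
        ((k / y) ^ k * (S.ζ p q k * (S.r : ℝ) ^ (p + q)) ^ S.r) =
      S.meijerFactor p q k *
        ((∫ x, Real.exp (-(y / S.opticalSNR x)) ∂S.opticalLaw : ℝ) : ℂ) := by
  have hk' : (0 : ℝ) < k := by exact_mod_cast hk0
  have hex : ∃ σ, SeparatesPoles 0 (S.r * (p + q + k) + k) (S.κ₅ p q k) (S.κ₆ k) σ :=
    ⟨1, (S.separatesPoles_iff hp hq hk0 1).2 one_pos⟩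
  have hσ := (S.separatesPoles_iff hp hq hk0 _).1 hex.choose_spec
  rw [meijerG, dif_pos hex]
  generalize hex.choose = σ at hσ
  have hI := (S.opticalSNR_moment (w := ((k * σ : ℝ) : ℂ)) (by
    rw [Complex.ofReal_re]; positivity)).1
  rw [integral_exp_neg_div S.measurable_opticalSNR S.opticalSNR_ae_pos (mul_pos hk' hσ) hy hI]
  set H : ℝ → ℂ := fun u => Complex.Gamma ((k * σ : ℝ) + u * Complex.I) *
    Complex.exp (-(Real.log y * ((k * σ : ℝ) + u * Complex.I))) *
      ∫ x, (S.opticalSNR x : ℂ) ^ (((k * σ : ℝ) : ℂ) + u * Complex.I) ∂S.opticalLaw with hH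
  have hcongr : ∀ t : ℝ, meijerIntegrand 0 (S.r * (p + q + k) + k) (S.κ₅ p q k) (S.κ₆ k)
        ((k / y) ^ k * (S.ζ p q k * (S.r : ℝ) ^ (p + q)) ^ S.r) (σ + t * Complex.I) =
      S.meijerFactor p q k * k * H (k * t) := by
    intro t
    rw [S.meijerIntegrand_eq_moment hp hq hk0 hpq hk hmean hy (by simpa using hσ)]
    have : (k : ℂ) * (σ + t * Complex.I) =
        ((k * σ : ℝ) : ℂ) + ((k * t : ℝ) : ℂ) * Complex.I := by push_cast; ring
    simp only [hH, this]
  simp_rw [hcongr]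
  rw [integral_const_mul, Measure.integral_comp_mul_left H, abs_of_pos (inv_pos.2 hk'),
    Complex.real_smul]
  have hk0' : (k : ℂ) ≠ 0 := by exact_mod_cast hk0.ne'
  push_cast
  field_simp

theorem prefactor_mul_meijerFactor {p q k : ℕ} (hp : 0 < p) (hq : 0 < q) (hk0 : 0 < k)
    (hk : (k : ℝ) = S.α₂ * p) :
    S.prefactor p q k * S.meijerFactor p q k = S.m * (S.N.choose S.m : ℝ) := by
  have hp' : (0 : ℝ) < p := by exact_mod_cast hp
  have hq' : (0 : ℝ) < q := by exact_mod_cast hq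
  have hk' : (0 : ℝ) < k := by exact_mod_cast hk0
  have hr' : (0 : ℝ) < S.r := by exact_mod_cast S.r_pos
  have ha2 := S.α₂_pos
  have hG1 := (Real.Gamma_pos_of_pos S.m₁_pos).ne'
  have hG2 := (Real.Gamma_pos_of_pos S.m₂_pos).ne'
  have hξ := S.ξ_pos.ne'
  -- The square root of `k` in `meijerFactor` supplies the `√α₂` and the missing half power of `p`.
  have hlk : Real.log k = Real.log S.α₂ + Real.log p := by rw [hk, Real.log_mul ha2.ne' hp'.ne']
  rw [prefactor, meijerFactor, Real.sqrt_eq_rpow, Real.rpow_def_of_pos hp', Real.rpow_def_of_pos hq',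
    Real.rpow_def_of_pos hr', Real.rpow_def_of_pos ha2, Real.rpow_def_of_pos (by positivity)]
  have key : ∀ a₁ a₂ a₃ a₄ a₅ a₆ : ℝ, a₁ + a₂ + a₃ + a₆ = a₄ + a₅ →
      S.m * S.ξ ^ 2 * Real.exp a₁ * Real.exp a₂ * Real.exp a₃ /
        (Real.exp a₄ * Real.Gamma S.m₁ * Real.Gamma S.m₂ * Real.exp a₅) * (S.N.choose S.m : ℝ) *
        (Real.exp a₆ * (Real.Gamma S.m₁ * Real.Gamma S.m₂ / S.ξ ^ 2)) =
      S.m * (S.N.choose S.m : ℝ) := by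
    intro a₁ a₂ a₃ a₄ a₅ a₆ h
    have h' := congrArg Real.exp h
    simp only [Real.exp_add] at h'
    have := Real.exp_ne_zero a₄
    have := Real.exp_ne_zero a₅
    field_simp
    linear_combination (S.m * (S.N.choose S.m : ℝ)) * h'
  refine key _ _ _ _ _ _ ?_
  rw [hlk]
  ring

end System

/-! ### The complex Gaussian law -/

section ComplexGaussian

open Set

instance (v : ℝ≥0) : IsProbabilityMeasure (complexGaussian v) :=
  Measure.isProbabilityMeasure_map (by fun_prop)

/-- The density of the complex Gaussian law. -/
noncomputable def complexGaussianDensity (v : ℝ≥0) (z : ℂ) : ℝ :=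
  (Real.pi * v)⁻¹ * Real.exp (-(‖z‖ ^ 2 / v))

theorem measurable_complexGaussianDensity (v : ℝ≥0) : Measurable (complexGaussianDensity v) := by
  unfold complexGaussianDensity; fun_prop

theorem complexGaussianDensity_nonneg (v : ℝ≥0) (z : ℂ) : 0 ≤ complexGaussianDensity v z := by
  unfold complexGaussianDensity; positivity

theorem complexGaussian_eq_withDensity {v : ℝ≥0} (hv : 0 < v) :
    complexGaussian v = volume.withDensity fun z => ENNReal.ofReal (complexGaussianDensity v z) := by
  have hv2 : v / 2 ≠ 0 := (half_pos hv).ne'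
  have hv' : (0 : ℝ) < v := by exact_mod_cast hv
  have hmap : (fun x : ℝ × ℝ => (x.1 : ℂ) + (x.2 : ℂ) * Complex.I) =
      Complex.measurableEquivRealProd.symm := by
    ext x; simp [Complex.measurableEquivRealProd_symm_apply, Complex.mk_eq_add_mul_I]
  refine Measure.ext fun s hs => ?_
  rw [complexGaussian, hmap, gaussianReal_of_var_ne_zero _ hv2,
    prod_withDensity (measurable_gaussianPDF _ _) (measurable_gaussianPDF _ _),
    MeasurableEquiv.map_apply, withDensity_apply _ hs,
    withDensity_apply _ (Complex.measurableEquivRealProd.symm.measurable hs),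
    ← Complex.volume_preserving_equiv_real_prod.symm.setLIntegral_comp_preimage hs
      (measurable_complexGaussianDensity v).ennreal_ofReal]
  refine lintegral_congr fun x => ?_
  rw [gaussianPDF, gaussianPDF, ← ENNReal.ofReal_mul (gaussianPDFReal_nonneg _ _ _)]
  congr 1
  have hn : ‖Complex.measurableEquivRealProd.symm x‖ ^ 2 = x.1 ^ 2 + x.2 ^ 2 := by
    rw [Complex.sq_norm, Complex.normSq_apply]
    simp [Complex.measurableEquivRealProd_symm_apply]; ring
  rw [complexGaussianDensity, hn, gaussianPDFReal, gaussianPDFReal, mul_mul_mul_comm,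
    ← Real.exp_add, ← mul_inv, Real.mul_self_sqrt (by positivity)]
  push_cast
  congr 2
  · ring
  · field_simp; ring

theorem complexGaussian_absolutelyContinuous {v : ℝ≥0} (hv : 0 < v) :
    complexGaussian v ≪ volume := by
  rw [complexGaussian_eq_withDensity hv]
  exact withDensity_absolutelyContinuous _ _

theorem integral_complexGaussian {v : ℝ≥0} (hv : 0 < v) (f : ℂ → ℝ) :
    ∫ z, f z ∂(complexGaussian v) = ∫ z, complexGaussianDensity v z * f z := by
  rw [complexGaussian_eq_withDensity hv, integral_withDensity_eq_integral_toReal_smul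
    (measurable_complexGaussianDensity v).ennreal_ofReal
    (Filter.Eventually.of_forall fun _ => ENNReal.ofReal_lt_top)]
  simp_rw [ENNReal.toReal_ofReal (complexGaussianDensity_nonneg _ _), smul_eq_mul]

theorem complexGaussian_norm_eq {v : ℝ≥0} (hv : 0 < v) (a : ℝ) :
    complexGaussian v {z | ‖z‖ = a} = 0 := by
  refine complexGaussian_absolutelyContinuous hv ?_
  have : {z : ℂ | ‖z‖ = a} = Metric.sphere 0 a := by ext z; simp
  rw [this]
  exact Measure.addHaar_sphere _ _ _

/-- In polar coordinates the radial density `(2 y / v) exp (-y² / v)` has an explicit primitive, so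
the squared norm is exponential with mean `v`. -/
theorem complexGaussian_lt_norm {v : ℝ≥0} (hv : 0 < v) {a : ℝ} (ha : 0 ≤ a) :
    (complexGaussian v).real {z | a < ‖z‖} = Real.exp (-(a ^ 2 / v)) := by
  have hv' : (0 : ℝ) < v := by exact_mod_cast hv
  have hs : MeasurableSet {z : ℂ | a < ‖z‖} := measurableSet_lt measurable_const measurable_norm
  rw [← integral_indicator_one hs, integral_complexGaussian hv]
  set f : ℝ → ℝ := fun y =>
    (Ioi a).indicator (fun y => (Real.pi * v)⁻¹ * Real.exp (-(y ^ 2 / v))) y with hf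
  have h1 : ∀ z : ℂ, complexGaussianDensity v z * {z : ℂ | a < ‖z‖}.indicator 1 z = f ‖z‖ := by
    intro z
    by_cases hz : a < ‖z‖ <;> simp [hf, complexGaussianDensity, indicator, hz]
  simp_rw [h1]
  rw [integral_fun_norm_addHaar volume f]
  have hsub : Ioi a ⊆ Ioi (0 : ℝ) := Ioi_subset_Ioi ha
  have h2 : ∫ y in Ioi (0 : ℝ), y ^ (Module.finrank ℝ ℂ - 1) • f y =
      ∫ y in Ioi a, (Real.pi)⁻¹ / 2 * (2 * y / v * Real.exp (-(y ^ 2 / v))) := by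
    have : (fun y : ℝ => y ^ (Module.finrank ℝ ℂ - 1) • f y) = (Ioi a).indicator
        fun y => (Real.pi)⁻¹ / 2 * (2 * y / v * Real.exp (-(y ^ 2 / v))) := by
      ext y
      by_cases hy : a < y
      · simp [hf, hy, Complex.finrank_real_complex]
        ring
      · simp [hf, hy]
    rw [this, setIntegral_indicator measurableSet_Ioi, inter_eq_right.2 hsub]
  have h3 : ∫ y in Ioi a, -(2 * y / v * Real.exp (-(y ^ 2 / v))) =
      0 - Real.exp (-(a ^ 2 / v)) := by
    refine integral_Ioi_of_hasDerivAt_of_nonpos' (g := fun y => Real.exp (-(y ^ 2 / v)))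
      (fun y _ => ?_) (fun y hy => ?_) ?_
    · have : HasDerivAt (fun x => Real.exp (-(x ^ 2 / (v : ℝ))))
          (Real.exp (-(y ^ 2 / v)) * -((2 : ℕ) * y ^ (2 - 1) / v)) y :=
        (((hasDerivAt_pow 2 y).div_const (v : ℝ)).neg).exp
      convert this using 1
      simp; ring
    · have : 0 < y := ha.trans_lt hy
      simp only [Left.neg_nonpos_iff]; positivity
    · refine Real.tendsto_exp_neg_atTop_nhds_zero.comp ?_
      exact (Filter.tendsto_pow_atTop two_ne_zero).atTop_div_const hv'
  rw [integral_neg, zero_sub, neg_inj] at h3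
  rw [h2, integral_const_mul, h3, Measure.real, Complex.volume_ball]
  simp [Complex.finrank_real_complex]
  field_simp

theorem complexGaussian_le_norm {v : ℝ≥0} (hv : 0 < v) {a : ℝ} (ha : 0 ≤ a) :
    (complexGaussian v).real {z | a ≤ ‖z‖} = Real.exp (-(a ^ 2 / v)) := by
  rw [← complexGaussian_lt_norm hv ha]
  refine measureReal_congr ?_
  have : ∀ᵐ z ∂(complexGaussian v), ‖z‖ ≠ a := by
    rw [ae_iff]; simpa using complexGaussian_norm_eq hv a
  filter_upwards [this] with z hz
  exact propext ⟨fun h => lt_of_le_of_ne h (Ne.symm hz), fun h => le_of_lt h⟩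

/-- Exponential tilting: multiplying the density of variance `v` by this weight gives `1 / l` times
the density of variance `v / l`. -/
theorem integral_complexGaussian_exp_mul {v : ℝ≥0} (hv : 0 < v) {l : ℝ≥0} (hl : 0 < l)
    (f : ℂ → ℝ) :
    ∫ z, Real.exp (-(‖z‖ ^ 2 / v)) ^ ((l : ℝ) - 1) * f z ∂(complexGaussian v) =
      (l : ℝ)⁻¹ * ∫ z, f z ∂(complexGaussian (v / l)) := by
  have hv' : (0 : ℝ) < v := by exact_mod_cast hv
  have hl' : (0 : ℝ) < l := by exact_mod_cast hl
  rw [integral_complexGaussian hv, integral_complexGaussian (div_pos hv hl), ← integral_const_mul]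
  refine integral_congr_ae (Filter.Eventually.of_forall fun z => ?_)
  simp only [complexGaussianDensity]
  rw [← Real.exp_mul]
  have : Real.exp (-(‖z‖ ^ 2 / ((v / l : ℝ≥0) : ℝ))) =
      Real.exp (-(‖z‖ ^ 2 / v)) * Real.exp (-(‖z‖ ^ 2 / v) * ((l : ℝ) - 1)) := by
    rw [← Real.exp_add]
    congr 1
    push_cast
    field_simp
    ring
  rw [this]
  push_cast
  field_simp

theorem charFun_complexGaussian (v : ℝ≥0) (t : ℂ) :
    charFun (complexGaussian v) t = Complex.exp (-(v * ‖t‖ ^ 2 / 4)) := by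
  rw [charFun_apply, complexGaussian, integral_map (by fun_prop) (by fun_prop)]
  have h : ∀ x : ℝ × ℝ, Complex.exp ((inner ℝ ((x.1 : ℂ) + (x.2 : ℂ) * Complex.I) t : ℝ) * Complex.I)
      = Complex.exp (t.re * x.1 * Complex.I) * Complex.exp (t.im * x.2 * Complex.I) := by
    intro x
    rw [← Complex.exp_add]
    congr 1
    rw [Complex.inner]
    simp
    ring
  simp_rw [h]
  rw [integral_prod_mul (fun x : ℝ => Complex.exp (t.re * x * Complex.I))
    (fun x : ℝ => Complex.exp (t.im * x * Complex.I)), ← charFun_apply_real, ← charFun_apply_real,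
    charFun_gaussianReal, charFun_gaussianReal, ← Complex.exp_add]
  congr 1
  have hn : (‖t‖ : ℂ) ^ 2 = (t.re : ℂ) * t.re + (t.im : ℂ) * t.im := by
    rw [← Complex.ofReal_pow, Complex.sq_norm, Complex.normSq_apply]
    push_cast; rfl
  rw [hn]
  push_cast
  ring

/-- Characteristic functions of independent summands multiply, and they determine the law. -/
theorem map_complexGaussian_prod (a b : ℝ) (u v : ℝ≥0) {w : ℝ≥0}
    (hw : (w : ℝ) = a ^ 2 * u + b ^ 2 * v) :
    ((complexGaussian u).prod (complexGaussian v)).map (fun x => (a : ℂ) * x.1 + (b : ℂ) * x.2) =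
      complexGaussian w := by
  have : IsProbabilityMeasure (((complexGaussian u).prod (complexGaussian v)).map
      (fun x : ℂ × ℂ => (a : ℂ) * x.1 + (b : ℂ) * x.2)) :=
    Measure.isProbabilityMeasure_map (by fun_prop)
  refine Measure.ext_of_charFun ?_
  ext t
  rw [charFun_apply, integral_map (by fun_prop) (by fun_prop)]
  have h : ∀ x : ℂ × ℂ, Complex.exp ((inner ℝ ((a : ℂ) * x.1 + (b : ℂ) * x.2) t : ℝ) * Complex.I)
      = Complex.exp ((inner ℝ x.1 (a * t) : ℝ) * Complex.I) *
        Complex.exp ((inner ℝ x.2 (b * t) : ℝ) * Complex.I) := by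
    intro x
    rw [← Complex.exp_add]
    congr 1
    simp only [Complex.inner]
    simp
    ring
  simp_rw [h]
  rw [integral_prod_mul (fun x : ℂ => Complex.exp ((inner ℝ x (a * t) : ℝ) * Complex.I))
    (fun x : ℂ => Complex.exp ((inner ℝ x (b * t) : ℝ) * Complex.I)), ← charFun_apply,
    ← charFun_apply, charFun_complexGaussian, charFun_complexGaussian, charFun_complexGaussian,
    ← Complex.exp_add]
  congr 1
  have hw' : (w : ℂ) = a ^ 2 * u + b ^ 2 * v := by exact_mod_cast congrArg (fun x : ℝ => (x : ℂ)) hw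
  rw [hw', norm_mul, norm_mul, Complex.norm_real, Complex.norm_real]
  have ha : ((‖a‖ : ℝ) : ℂ) ^ 2 = (a : ℂ) ^ 2 := by
    rw [← Complex.ofReal_pow, Real.norm_eq_abs, sq_abs, Complex.ofReal_pow]
  have hb : ((‖b‖ : ℝ) : ℂ) ^ 2 = (b : ℂ) ^ 2 := by
    rw [← Complex.ofReal_pow, Real.norm_eq_abs, sq_abs, Complex.ofReal_pow]
  push_cast
  rw [mul_pow, mul_pow, ha, hb]
  ring

end ComplexGaussian

/-! ### The order statistics of the outdated gains -/

section OrderStatistics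

open Set

/-- The sort is stable, so it follows the lexicographic order of value and index. The position of
`i` is the number of its predecessors in that order. -/
theorem sort_apply_eq_iff {n : ℕ} (f : Fin n → ℝ) (i j : Fin n) :
    Tuple.sort f j = i ↔
      (Finset.univ.filter fun l => f l < f i ∨ f l = f i ∧ l < i).card = (j : ℕ) := by
  set s := Tuple.sort f with hs
  obtain ⟨h1, h2⟩ := Tuple.eq_sort_iff.1 hs
  have h3 : ∀ a b, a < b → (f (s a) < f (s b) ∨ f (s a) = f (s b) ∧ s a < s b) := by
    intro a b hab
    rcases (h1 hab.le).lt_or_eq with h | h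
    · exact Or.inl h
    · exact Or.inr ⟨h, h2 a b hab h⟩
  have h4 : ∀ a b, (f (s a) < f (s b) ∨ f (s a) = f (s b) ∧ s a < s b) ↔ a < b := by
    refine fun a b => ⟨fun h => ?_, h3 a b⟩
    by_contra hab
    rcases (not_lt.1 hab).lt_or_eq with hba | rfl
    · rcases h3 b a hba with h' | ⟨h', h''⟩ <;> rcases h with h | ⟨h, h'''⟩ <;>
        first | linarith | exact lt_asymm h'' h'''
    · simp at h
  have h5 : ∀ b, (Finset.univ.filter fun l => f l < f (s b) ∨ f l = f (s b) ∧ l < s b).card =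
      (b : ℕ) := by
    intro b
    rw [← Fin.card_Iio b]
    refine (Finset.card_equiv s fun a => ?_).symm
    simp [h4]
  obtain ⟨b, rfl⟩ := s.surjective i
  rw [h5, s.apply_eq_iff_eq, Fin.ext_iff, eq_comm]

theorem measurableSet_card_filter {ι Y : Type*} [Fintype ι] [MeasurableSpace Y]
    {A : ι → Set Y} (hA : ∀ l, MeasurableSet (A l)) [∀ y l, Decidable (y ∈ A l)] (k : ℕ) :
    MeasurableSet {y | (Finset.univ.filter fun l => y ∈ A l).card = k} := by
  have : Measurable fun y => (Finset.univ.filter fun l => y ∈ A l).card := by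
    simp only [Finset.card_filter]
    exact Finset.measurable_sum _ fun l _ => Measurable.ite (hA l) measurable_const measurable_const
  exact this (measurableSet_singleton k)

open Classical in
-- A binomial law, obtained by splitting over the set of successful indices. The events may depend
-- on the index, as tie-breaking requires; only their probabilities agree.
theorem pi_card_filter_eq {ι X : Type*} [Fintype ι] [MeasurableSpace X] (P : Measure X)
    [IsProbabilityMeasure P] {A : ι → Set X} (hA : ∀ l, MeasurableSet (A l)) {a b : ENNReal}
    (ha : ∀ l, P (A l) = a) (hb : ∀ l, P (A l)ᶜ = b) (k : ℕ) :
    Measure.pi (fun _ : ι => P) {h | (Finset.univ.filter fun l => h l ∈ A l).card = k} =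
      (Fintype.card ι).choose k * (a ^ k * b ^ (Fintype.card ι - k)) := by
  have hset : {h : ι → X | (Finset.univ.filter fun l => h l ∈ A l).card = k} =
      ⋃ T ∈ Finset.powersetCard k (Finset.univ : Finset ι),
        Set.pi univ fun l => if l ∈ T then A l else (A l)ᶜ := by
    ext h
    simp only [mem_ofPred_eq, mem_iUnion, Finset.mem_powersetCard, exists_prop, Set.mem_pi, mem_univ,
      true_implies]
    constructor
    · intro hk
      refine ⟨_, ⟨Finset.subset_univ _, hk⟩, fun l => ?_⟩
      by_cases hl : h l ∈ A l <;> simp [hl]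
    · rintro ⟨T, ⟨-, hT⟩, hl⟩
      rw [← hT]
      congr 1
      ext l
      have := hl l
      by_cases hlT : l ∈ T <;> simp [hlT] at this ⊢ <;> exact this
  have hmeas : ∀ T : Finset ι, ∀ l, MeasurableSet (if l ∈ T then A l else (A l)ᶜ) := by
    intro T l
    split_ifs
    · exact hA l
    · exact (hA l).compl
  rw [hset, measure_biUnion_finset]
  · rw [Finset.sum_congr rfl (g := fun _ => a ^ k * b ^ (Fintype.card ι - k))]
    · rw [Finset.sum_const, Finset.card_powersetCard, Finset.card_univ, nsmul_eq_mul]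
    · intro T hT
      obtain ⟨-, hT⟩ := Finset.mem_powersetCard.1 hT
      rw [Measure.pi_pi]
      have : ∀ l, P (if l ∈ T then A l else (A l)ᶜ) = if l ∈ T then a else b := by
        intro l; split_ifs
        · exact ha l
        · exact hb l
      simp_rw [this]
      rw [Finset.prod_ite, Finset.prod_const, Finset.prod_const]
      have e1 : (Finset.univ.filter fun l => l ∈ T) = T := by ext; simp
      have e2 : (Finset.univ.filter fun l => l ∉ T) = Tᶜ := by ext; simp
      rw [e1, e2, Finset.card_compl, hT]
  · intro T _ U _ hTU
    rw [Function.onFun, Set.disjoint_left]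
    intro h h1 h2
    apply hTU
    ext l
    have h1 := h1 l (mem_univ l)
    have h2 := h2 l (mem_univ l)
    by_cases hT : l ∈ T <;> by_cases hU : l ∈ U <;> simp [hT, hU] at h1 h2 ⊢ <;> tauto
  · intro T _
    exact MeasurableSet.univ_pi (hmeas T)

variable {v : ℝ≥0}

/-- Ties have probability zero, so the tie-breaking condition `c` has no effect. -/
theorem complexGaussian_beaten (hv : 0 < v) {F : ℂ → ℝ} (hF : ∀ z w, F z < F w ↔ ‖z‖ < ‖w‖)
    (z : ℂ) (c : Prop) :
    complexGaussian v {w | F w < F z ∨ F w = F z ∧ c} =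
      ENNReal.ofReal (1 - Real.exp (-(‖z‖ ^ 2 / v))) ∧
    complexGaussian v {w | F w < F z ∨ F w = F z ∧ c}ᶜ =
      ENNReal.ofReal (Real.exp (-(‖z‖ ^ 2 / v))) := by
  have hne : ∀ᵐ w ∂(complexGaussian v), ‖w‖ ≠ ‖z‖ := by
    rw [ae_iff]; simpa using complexGaussian_norm_eq hv ‖z‖
  have heq : ∀ w, F w = F z → ‖w‖ = ‖z‖ := fun w h =>
    le_antisymm (not_lt.1 fun h' => ((hF z w).2 h').ne' h) (not_lt.1 fun h' => ((hF w z).2 h').ne h)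
  set T : Set ℂ := {w | ‖z‖ ≤ ‖w‖} with hT
  set U : Set ℂ := {w | F w < F z ∨ F w = F z ∧ c} with hU
  have h1 : U =ᵐ[complexGaussian v] (Tᶜ : Set ℂ) := by
    filter_upwards [hne] with w hw
    refine propext ⟨fun h => ?_, fun h => Or.inl ((hF w z).2 (not_le.1 h))⟩
    rcases h with h | ⟨h, -⟩
    · exact not_le.2 ((hF w z).1 h)
    · exact absurd (heq w h) hw
  have hm : MeasurableSet T := measurableSet_le measurable_const measurable_norm
  have h2 : complexGaussian v T = ENNReal.ofReal (Real.exp (-(‖z‖ ^ 2 / v))) := by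
    rw [← complexGaussian_le_norm hv (norm_nonneg z), ofReal_measureReal]
  refine ⟨?_, ?_⟩
  · rw [measure_congr h1, prob_compl_eq_one_sub hm, h2, ENNReal.ofReal_sub _ (Real.exp_pos _).le,
      ENNReal.ofReal_one]
  · exact (measure_congr (ae_eq_set_compl.2 h1)).trans h2

/-- Condition on the `i`-th gain `z`: it takes position `j` when exactly `j` of the other `N - 1`
independent gains precede it. The index `i` never precedes itself, so removing it does not change
the count. -/
theorem lintegral_indicator_sort (hv : 0 < v) {F : ℂ → ℝ} (hFm : Measurable F)
    (hF : ∀ z w, F z < F w ↔ ‖z‖ < ‖w‖) {N : ℕ} (i j : Fin N) {φ : ℂ → ENNReal}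
    (hφ : Measurable φ) :
    ∫⁻ h, {h : Fin N → ℂ | Tuple.sort (fun l => F (h l)) j = i}.indicator (fun h => φ (h i)) h
        ∂(Measure.pi fun _ => complexGaussian v) =
      ∫⁻ z, φ z * ((N - 1).choose j * (ENNReal.ofReal (1 - Real.exp (-(‖z‖ ^ 2 / v))) ^ (j : ℕ) *
        ENNReal.ofReal (Real.exp (-(‖z‖ ^ 2 / v))) ^ (N - 1 - j))) ∂(complexGaussian v) := by
  classical
  obtain ⟨n, rfl⟩ : ∃ n, N = n + 1 := ⟨N - 1, by have := i.pos; omega⟩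
  set E : Fin n → Set (ℂ × (Fin n → ℂ)) := fun l =>
    {x | F (x.2 l) < F x.1 ∨ F (x.2 l) = F x.1 ∧ i.succAbove l < i} with hE
  have hEm : ∀ l, MeasurableSet (E l) := by
    intro l
    have h1 : Measurable fun x : ℂ × (Fin n → ℂ) => F (x.2 l) := by fun_prop
    have h2 : Measurable fun x : ℂ × (Fin n → ℂ) => F x.1 := by fun_prop
    exact (measurableSet_lt h1 h2).union ((measurableSet_eq_fun h1 h2).inter (.const _))
  set D : Set (ℂ × (Fin n → ℂ)) := {x | (Finset.univ.filter fun l => x ∈ E l).card = (j : ℕ)} with hD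
  have hDm : MeasurableSet D := measurableSet_card_filter hEm j
  have hmp := measurePreserving_piFinSuccAbove (fun _ : Fin (n + 1) => complexGaussian v) i
  have hpt : ∀ h : Fin (n + 1) → ℂ,
      {h : Fin (n + 1) → ℂ | Tuple.sort (fun l => F (h l)) j = i}.indicator (fun h => φ (h i)) h =
      D.indicator (φ ∘ Prod.fst)
        (MeasurableEquiv.piFinSuccAbove (fun _ => ℂ) i h) := by
    intro h
    have hx : MeasurableEquiv.piFinSuccAbove (fun _ => ℂ) i h = (h i, fun l => h (i.succAbove l)) :=
      rfl
    have hiff : Tuple.sort (fun l => F (h l)) j = i ↔ (h i, fun l => h (i.succAbove l)) ∈ D := by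
      rw [sort_apply_eq_iff, hD, mem_ofPred_eq]
      have : (Finset.univ.filter fun l => F (h l) < F (h i) ∨ F (h l) = F (h i) ∧ l < i).card =
          (Finset.univ.filter fun l : Fin n =>
            (h i, fun l => h (i.succAbove l)) ∈ E l).card := by
        rw [Finset.card_filter, Finset.card_filter, Fin.sum_univ_succAbove _ i]
        simp [hE]
      rw [this]
    rw [hx]
    by_cases hc : Tuple.sort (fun l => F (h l)) j = i
    · rw [indicator_of_mem (by exact hc), indicator_of_mem (hiff.1 hc)]; rfl
    · rw [indicator_of_notMem (by exact hc), indicator_of_notMem (fun h' => hc (hiff.2 h'))]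
  simp_rw [hpt]
  rw [hmp.lintegral_comp ((hφ.comp measurable_fst).indicator hDm),
    lintegral_prod _ ((hφ.comp measurable_fst).indicator hDm).aemeasurable]
  refine lintegral_congr fun z => ?_
  have hind : ∀ y : Fin n → ℂ, D.indicator (φ ∘ Prod.fst) (z, y) =
      (Prod.mk z ⁻¹' D).indicator (fun _ => φ z) y := fun y => rfl
  simp only [hind]
  rw [lintegral_indicator_const (measurable_prodMk_left hDm)]
  congr 1
  have hset : Prod.mk z ⁻¹' D = {y | (Finset.univ.filter fun l => y l ∈
      {w | F w < F z ∨ F w = F z ∧ i.succAbove l < i}).card = (j : ℕ)} := by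
    ext y; rfl
  have hm : ∀ l : Fin n, MeasurableSet {w | F w < F z ∨ F w = F z ∧ i.succAbove l < i} := by
    intro l
    exact (measurableSet_lt hFm measurable_const).union
      ((measurableSet_eq_fun hFm measurable_const).inter (.const _))
  rw [hset]
  have := pi_card_filter_eq (complexGaussian v) hm
    (fun l => (complexGaussian_beaten hv hF z _).1) (fun l => (complexGaussian_beaten hv hF z _).2) j
  rw [Fintype.card_fin] at this
  rw [Nat.add_sub_cancel]
  convert this

theorem measurableSet_sort_eq {F : ℂ → ℝ} (hFm : Measurable F) {N : ℕ} (j i : Fin N) :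
    MeasurableSet {h : Fin N → ℂ | Tuple.sort (fun l => F (h l)) j = i} := by
  classical
  simp only [sort_apply_eq_iff]
  refine measurableSet_card_filter (A := fun l => {h : Fin N → ℂ |
    F (h l) < F (h i) ∨ F (h l) = F (h i) ∧ l < i}) (fun l => ?_) j
  have h1 : ∀ l, Measurable fun h : Fin N → ℂ => F (h l) := fun l => by fun_prop
  exact (measurableSet_lt (h1 l) (h1 i)).union
    ((measurableSet_eq_fun (h1 l) (h1 i)).inter (.const _))

/-- Split according to the selected index. The selection depends only on the first family, so the
second gain at that index keeps its law; by symmetry the `N` terms are equal. -/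
theorem pair_sort_law (hv : 0 < v) {F : ℂ → ℝ} (hFm : Measurable F)
    (hF : ∀ z w, F z < F w ↔ ‖z‖ < ‖w‖) {N : ℕ} (j : Fin N) {B : Set (ℂ × ℂ)}
    (hB : MeasurableSet B) :
    ((Measure.pi fun _ : Fin N => complexGaussian v).prod
        (Measure.pi fun _ : Fin N => complexGaussian v))
        {x | (x.1 (Tuple.sort (fun l => F (x.1 l)) j), x.2 (Tuple.sort (fun l => F (x.1 l)) j)) ∈ B} =
      N * ∫⁻ z, complexGaussian v (Prod.mk z ⁻¹' B) *
        ((N - 1).choose j * (ENNReal.ofReal (1 - Real.exp (-(‖z‖ ^ 2 / v))) ^ (j : ℕ) *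
        ENNReal.ofReal (Real.exp (-(‖z‖ ^ 2 / v))) ^ (N - 1 - j))) ∂(complexGaussian v) := by
  classical
  set P := Measure.pi fun _ : Fin N => complexGaussian v with hP
  have hsel := measurableSet_sort_eq hFm j
  have hunion : {x : (Fin N → ℂ) × (Fin N → ℂ) | (x.1 (Tuple.sort (fun l => F (x.1 l)) j),
      x.2 (Tuple.sort (fun l => F (x.1 l)) j)) ∈ B} =
      ⋃ i ∈ (Finset.univ : Finset (Fin N)), {x : (Fin N → ℂ) × (Fin N → ℂ) |
        x.1 ∈ {h : Fin N → ℂ | Tuple.sort (fun l => F (h l)) j = i} ∧ (x.1 i, x.2 i) ∈ B} := by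
    ext x
    simp
  have hm : ∀ i, MeasurableSet {x : (Fin N → ℂ) × (Fin N → ℂ) |
        x.1 ∈ {h : Fin N → ℂ | Tuple.sort (fun l => F (h l)) j = i} ∧ (x.1 i, x.2 i) ∈ B} := by
    intro i
    exact (measurable_fst (hsel i)).inter
      ((((measurable_pi_apply i).comp measurable_fst).prodMk
        ((measurable_pi_apply i).comp measurable_snd)) hB)
  rw [hunion, measure_biUnion_finset]
  · rw [Finset.sum_congr rfl (g := fun _ => _) fun i _ => ?_, Finset.sum_const, Finset.card_univ,
      Fintype.card_fin, nsmul_eq_mul]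
    rw [Measure.prod_apply (hm i), ← lintegral_indicator_sort hv hFm hF i j
      (measurable_measure_prodMk_left hB)]
    refine lintegral_congr fun h => ?_
    by_cases hc : Tuple.sort (fun l => F (h l)) j = i
    · rw [indicator_of_mem (by exact hc)]
      have : Prod.mk h ⁻¹' {x : (Fin N → ℂ) × (Fin N → ℂ) |
        x.1 ∈ {h : Fin N → ℂ | Tuple.sort (fun l => F (h l)) j = i} ∧ (x.1 i, x.2 i) ∈ B} =
        (fun w : Fin N → ℂ => w i) ⁻¹' (Prod.mk (h i) ⁻¹' B) := by
        ext w; simp [hc]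
      rw [this]
      exact (measurePreserving_eval (fun _ : Fin N => complexGaussian v) i).measure_preimage
        (measurable_prodMk_left hB).nullMeasurableSet
    · rw [indicator_of_notMem (by exact hc)]
      have : Prod.mk h ⁻¹' {x : (Fin N → ℂ) × (Fin N → ℂ) |
        x.1 ∈ {h : Fin N → ℂ | Tuple.sort (fun l => F (h l)) j = i} ∧ (x.1 i, x.2 i) ∈ B} = ∅ := by
        ext w; simp [hc]
      rw [this, measure_empty]
  · intro i _ i' _ hne
    rw [Function.onFun, Set.disjoint_left]
    rintro x ⟨h1, -⟩ ⟨h2, -⟩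
    exact hne (h1.symm.trans h2)
  · exact fun i _ => hm i

theorem pair_sort_law_real (hv : 0 < v) {F : ℂ → ℝ} (hFm : Measurable F)
    (hF : ∀ z w, F z < F w ↔ ‖z‖ < ‖w‖) {N : ℕ} (j : Fin N) {B : Set (ℂ × ℂ)}
    (hB : MeasurableSet B) :
    ((Measure.pi fun _ : Fin N => complexGaussian v).prod
        (Measure.pi fun _ : Fin N => complexGaussian v)).real
        {x | (x.1 (Tuple.sort (fun l => F (x.1 l)) j), x.2 (Tuple.sort (fun l => F (x.1 l)) j)) ∈ B} =
      N * (N - 1).choose j * ∑ n ∈ Finset.range (j + 1), ((j : ℕ).choose n : ℝ) * (-1) ^ n *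
        (((N - j + n : ℕ) : ℝ)⁻¹ *
          ((complexGaussian (v / (N - j + n : ℕ))).prod (complexGaussian v)).real B) := by
  set f : ℂ → ℝ := fun z => (complexGaussian v).real (Prod.mk z ⁻¹' B) with hf
  have hfm : Measurable f := (measurable_measure_prodMk_left hB).ennreal_toReal
  have hf0 : ∀ z, 0 ≤ f z := fun z => measureReal_nonneg
  have hf1 : ∀ z, f z ≤ 1 := fun z => measureReal_le_one
  have hE1 : ∀ z : ℂ, Real.exp (-(‖z‖ ^ 2 / v)) ≤ 1 := fun z => by
    rw [Real.exp_le_one_iff, neg_nonpos]; positivity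
  have hprod : ∀ u : ℝ≥0, ((complexGaussian u).prod (complexGaussian v)).real B =
      ∫ z, f z ∂(complexGaussian u) := by
    intro u
    rw [Measure.real, Measure.prod_apply hB, ← integral_toReal
      (measurable_measure_prodMk_left hB).aemeasurable
      (Filter.Eventually.of_forall fun _ => measure_lt_top _ _)]
    rfl
  have hint : ∀ l : ℕ, Integrable
      (fun z => Real.exp (-(‖z‖ ^ 2 / v)) ^ l * f z) (complexGaussian v) := by
    intro l
    refine Integrable.of_bound (by fun_prop) 1 (Filter.Eventually.of_forall fun z => ?_)
    rw [Real.norm_of_nonneg (mul_nonneg (by positivity) (hf0 z))]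
    exact mul_le_one₀ (pow_le_one₀ (Real.exp_pos _).le (hE1 z)) (hf0 z) (hf1 z)
  rw [Measure.real, pair_sort_law hv hFm hF j hB, ENNReal.toReal_mul, ENNReal.toReal_natCast,
    ← integral_toReal (by
      have h0 := measurable_measure_prodMk_left (ν := complexGaussian v) hB
      fun_prop) (Filter.Eventually.of_forall fun z => by
        refine ENNReal.mul_lt_top (measure_lt_top _ _) (ENNReal.mul_lt_top (by simp)
          (ENNReal.mul_lt_top ?_ ?_)) <;> exact ENNReal.pow_lt_top ENNReal.ofReal_lt_top)]
  have hpt : ∀ z : ℂ, (complexGaussian v (Prod.mk z ⁻¹' B) *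
        ((N - 1).choose j * (ENNReal.ofReal (1 - Real.exp (-(‖z‖ ^ 2 / v))) ^ (j : ℕ) *
        ENNReal.ofReal (Real.exp (-(‖z‖ ^ 2 / v))) ^ (N - 1 - j)))).toReal =
      ((N - 1).choose j : ℝ) * ∑ n ∈ Finset.range (j + 1), ((j : ℕ).choose n : ℝ) * (-1) ^ n *
        (Real.exp (-(‖z‖ ^ 2 / v)) ^ (N - 1 - j + n) * f z) := by
    intro z
    rw [ENNReal.toReal_mul, ENNReal.toReal_mul, ENNReal.toReal_mul, ENNReal.toReal_pow,
      ENNReal.toReal_pow, ENNReal.toReal_ofReal (sub_nonneg.2 (hE1 z)),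
      ENNReal.toReal_ofReal (Real.exp_pos _).le, ENNReal.toReal_natCast]
    -- Binomial expansion of `(1 - e) ^ j`, which leaves only powers of `e`.
    have hb := add_pow (-Real.exp (-(‖z‖ ^ 2 / v))) 1 (j : ℕ)
    rw [neg_add_eq_sub] at hb
    rw [hb, Finset.sum_mul, Finset.mul_sum, Finset.mul_sum, Finset.mul_sum]
    refine Finset.sum_congr rfl fun n _ => ?_
    rw [neg_pow, pow_add]
    simp only [hf, Measure.real]
    ring
  simp_rw [hpt]
  rw [integral_const_mul, integral_finsetSum _ fun n _ => (hint _).const_mul _, ← mul_assoc]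
  congr 1
  refine Finset.sum_congr rfl fun n _ => ?_
  rw [integral_const_mul, hprod]
  congr 1
  have hl : 0 < N - (j : ℕ) + n := by have := j.isLt; omega
  have h := integral_complexGaussian_exp_mul hv (l := ((N - j + n : ℕ) : ℝ≥0))
    (by exact_mod_cast hl) f
  rw [NNReal.coe_natCast] at h
  rw [← h]
  refine integral_congr_ae (Filter.Eventually.of_forall fun z => ?_)
  simp only
  rw [← Real.rpow_natCast]
  congr 2
  have := j.isLt
  -- The weight has exponent `l - 1` with `l = N - j + n`, as the tilting lemma requires.
  rw [show N - (j : ℕ) + n = (N - 1 - j + n) + 1 by omega]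
  push_cast
  ring

end OrderStatistics

/-! ### The distortion of the amplifiers is nonnegative -/

section Distortion

open Set Filter Topology

/-- A discriminant form of Cauchy–Schwarz. It is applied with `M` a normalized output power and `b`
a normalized amplifier scale. -/
theorem sq_le_of_forall_quadratic_nonneg {M b : ℝ} (h : ∀ s : ℝ, 0 ≤ s ^ 2 * M - 2 * s * b + 1) :
    b ^ 2 ≤ M := by
  have := discrim_le_zero (a := M) (b := -2 * b) (c := 1) fun s => by linarith [h s]
  rw [discrim] at this
  linarith

theorem two_mul_integral_exp_neg_sq_le {b s : ℝ} (hb : 0 < b) (hs : 0 ≤ s) :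
    2 * s * b * ∫ t in Ioi b, Real.exp (-t ^ 2) ≤
      ((s - 1) ^ 2 * b ^ 2 + 1) * Real.exp (-b ^ 2) := by
  -- Chosen so that `-g'` is the wanted integrand plus a nonnegative square term, while `g b` is the
  -- right-hand side.
  set g : ℝ → ℝ := fun x => ((s * b - x) ^ 2 + 1) * Real.exp (-x ^ 2) with hg
  set g' : ℝ → ℝ := fun x => -(2 * s * b * Real.exp (-x ^ 2)) -
    2 * x * (s * b - x) ^ 2 * Real.exp (-x ^ 2) with hg'
  have hd : ∀ x ∈ Ici b, HasDerivAt g (g' x) x := by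
    intro x _
    have h1 : HasDerivAt (fun x : ℝ => (s * b - x) ^ 2 + 1) (-(2 * (s * b - x))) x := by
      refine HasDerivAt.congr_deriv
        ((((hasDerivAt_id x).const_sub (s * b)).pow 2).add_const (1 : ℝ)) ?_
      simp
    have h2 : HasDerivAt (fun x : ℝ => Real.exp (-x ^ 2)) (Real.exp (-x ^ 2) * -(2 * x)) x := by
      refine HasDerivAt.congr_deriv ((hasDerivAt_pow 2 x).neg).exp ?_
      simp
    refine HasDerivAt.congr_deriv (h1.mul h2) ?_
    simp only [hg']; ring
  have hneg : ∀ x ∈ Ioi b, g' x ≤ 0 := by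
    intro x hx
    have hx0 : 0 < x := hb.trans hx
    have : 0 ≤ 2 * s * b * Real.exp (-x ^ 2) := by positivity
    have : 0 ≤ 2 * x * (s * b - x) ^ 2 * Real.exp (-x ^ 2) := by positivity
    simp only [hg']; linarith
  have htend : Tendsto g atTop (𝓝 0) := by
    have h0 := Real.tendsto_pow_mul_exp_neg_atTop_nhds_zero 0
    have h1 := Real.tendsto_pow_mul_exp_neg_atTop_nhds_zero 1
    have h2 : Tendsto (fun y : ℝ => (2 * (s * b) ^ 2 + 1) * (y ^ 0 * Real.exp (-y)) +
        2 * (y ^ 1 * Real.exp (-y))) atTop (𝓝 0) := by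
      simpa using (h0.const_mul (2 * (s * b) ^ 2 + 1)).add (h1.const_mul 2)
    refine squeeze_zero (fun x => by simp only [hg]; positivity) (fun x => ?_)
      (h2.comp (tendsto_pow_atTop (α := ℝ) two_ne_zero))
    simp only [hg, Function.comp, pow_zero, one_mul, pow_one]
    rw [← mul_assoc, ← add_mul]
    refine mul_le_mul_of_nonneg_right ?_ (Real.exp_pos _).le
    nlinarith [sq_nonneg (s * b + x)]
  have hI := integral_Ioi_of_hasDerivAt_of_nonpos' hd hneg htend
  have hint := integrableOn_Ioi_deriv_of_nonpos' hd hneg htend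
  have hG : IntegrableOn (fun t : ℝ => 2 * s * b * Real.exp (-t ^ 2)) (Ioi b) := by
    have := (integrable_exp_neg_mul_sq one_pos).integrableOn (s := Ioi b)
    simp only [neg_one_mul] at this
    exact this.const_mul _
  have hle : ∫ t in Ioi b, 2 * s * b * Real.exp (-t ^ 2) ≤ ∫ t in Ioi b, -g' t := by
    refine setIntegral_mono_on hG hint.neg measurableSet_Ioi fun x hx => ?_
    have hx0 : 0 < x := hb.trans hx
    have : 0 ≤ 2 * x * (s * b - x) ^ 2 * Real.exp (-x ^ 2) := by positivity
    simp only [hg']; linarith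
  rw [integral_const_mul, integral_neg, hI] at hle
  refine hle.trans (le_of_eq ?_)
  simp only [hg]; ring

theorem integrableOn_exp_neg_div {a : ℝ} (ha : 0 < a) :
    IntegrableOn (fun t => Real.exp (-t) / t) (Ioi a) := by
  refine Integrable.mono' ((integrableOn_exp_neg_Ioi a).const_mul a⁻¹)
    (by fun_prop : Measurable fun t : ℝ => Real.exp (-t) / t).aestronglyMeasurable ?_
  filter_upwards [ae_restrict_mem measurableSet_Ioi] with t ht
  have ht0 : 0 < t := ha.trans ht
  rw [Real.norm_of_nonneg (by positivity), div_eq_inv_mul]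
  exact mul_le_mul_of_nonneg_right (inv_anti₀ ha (le_of_lt ht)) (Real.exp_pos _).le

/-- The difference of the two sides is the integral over `t > a` of the nonnegative function `(s / t
- 1)² (t - a) exp (-t)`; `h` is a primitive that removes every term except the exponential integral.
-/
theorem exp_neg_mul_le_integral_exp_neg_div {a : ℝ} (ha : 0 < a) (s : ℝ) :
    Real.exp (-a) * (s ^ 2 + 2 * s - 1) ≤
      (s ^ 2 * (1 + a) + 2 * s * a) * ∫ t in Ioi a, Real.exp (-t) / t := by
  set K := s ^ 2 * (1 + a) + 2 * s * a with hK
  set h : ℝ → ℝ := fun t => Real.exp (-t) * (t + 1 - a - 2 * s - s ^ 2 * a / t) with hh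
  set n : ℝ → ℝ := fun t => (s / t - 1) ^ 2 * (t - a) * Real.exp (-t) with hn
  set h' : ℝ → ℝ := fun t => K * (Real.exp (-t) / t) - n t with hh'
  have hd : ∀ t ∈ Ici a, HasDerivAt h (h' t) t := by
    intro t ht
    have ht0 : 0 < t := ha.trans_le ht
    have h1 : HasDerivAt (fun t : ℝ => Real.exp (-t)) (Real.exp (-t) * -1) t :=
      (hasDerivAt_neg t).exp
    have h2 : HasDerivAt (fun t : ℝ => t + 1 - a - 2 * s - s ^ 2 * a / t)
        (1 - s ^ 2 * a * -(t ^ 2)⁻¹) t := by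
      have := ((((hasDerivAt_id t).add_const (1 : ℝ)).sub_const a).sub_const (2 * s)).sub
        ((hasDerivAt_inv ht0.ne').const_mul (s ^ 2 * a))
      exact this
    refine HasDerivAt.congr_deriv (h1.mul h2) ?_
    simp only [hh', hn, hK]
    field_simp
    ring
  have hn0 : ∀ t ∈ Ioi a, 0 ≤ n t := by
    intro t ht
    have : 0 < t - a := sub_pos.2 ht
    simp only [hn]; positivity
  have hnint : IntegrableOn n (Ioi a) := by
    have h2 : IntegrableOn (fun t : ℝ => Real.exp (-t) * t ^ ((2 : ℝ) - 1)) (Ioi a) :=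
      (Real.GammaIntegral_convergent (s := 2) two_pos).mono_set (Ioi_subset_Ioi ha.le)
    refine Integrable.mono' (h2.const_mul ((|s| / a + 1) ^ 2))
      (by fun_prop : Measurable n).aestronglyMeasurable ?_
    filter_upwards [ae_restrict_mem measurableSet_Ioi] with t ht
    have ht0 : 0 < t := ha.trans ht
    rw [Real.norm_of_nonneg (hn0 t ht)]
    have e1 : (s / t - 1) ^ 2 ≤ (|s| / a + 1) ^ 2 := by
      rw [sq_le_sq]
      have : |s / t - 1| ≤ |s| / t + 1 := by
        refine (abs_sub _ _).trans ?_
        rw [abs_div, abs_of_pos ht0, abs_one]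
      have h3 : |s| / t ≤ |s| / a := div_le_div_of_nonneg_left (abs_nonneg s) ha (le_of_lt ht)
      refine (this.trans (by linarith)).trans (le_abs_self _)
    have e2 : t ^ ((2 : ℝ) - 1) = t := by norm_num
    rw [e2]
    simp only [hn]
    rw [mul_assoc, mul_comm (t - a)]
    have : 0 < t - a := sub_pos.2 ht
    refine mul_le_mul e1 (mul_le_mul_of_nonneg_left (by linarith) (Real.exp_pos _).le)
      (by positivity) (by positivity)
  have hE := integrableOn_exp_neg_div ha
  have hint : IntegrableOn h' (Ioi a) := (hE.const_mul K).sub hnint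
  have htend : Tendsto h atTop (𝓝 0) := by
    have h0 : Tendsto (fun t : ℝ => Real.exp (-t)) atTop (𝓝 0) :=
      Real.tendsto_exp_neg_atTop_nhds_zero
    have h1 := Real.tendsto_pow_mul_exp_neg_atTop_nhds_zero 1
    have h2 : Tendsto (fun t : ℝ => s ^ 2 * a / t) atTop (𝓝 0) :=
      tendsto_const_nhds.div_atTop tendsto_id
    have h3 := (h1.add (h0.const_mul (1 - a - 2 * s))).sub (h0.mul h2)
    simp only [mul_zero, add_zero, sub_zero] at h3
    refine h3.congr fun t => ?_
    simp only [hh]; ring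
  have hI := integral_Ioi_of_hasDerivAt_of_tendsto' hd hint htend
  have hle : 0 ≤ ∫ t in Ioi a, n t := setIntegral_nonneg measurableSet_Ioi hn0
  have hsub : ∫ t in Ioi a, h' t =
      K * (∫ t in Ioi a, Real.exp (-t) / t) - ∫ t in Ioi a, n t := by
    simp only [hh']
    rw [integral_sub (hE.const_mul K) hnint, integral_const_mul]
  rw [hsub] at hI
  have hha : h a = Real.exp (-a) * (1 - 2 * s - s ^ 2) := by
    simp only [hh]; field_simp; ring
  rw [hha] at hI
  linarith

theorem distortion_sel_nonneg {A σr : ℝ} (hA : 0 < A) (hσ : 0 < σr) :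
    0 ≤ Amplifier.sel.distortion A σr := by
  set b := A / σr with hb
  have hb0 : 0 < b := div_pos hA hσ
  have hb2 : A ^ 2 / σr ^ 2 = b ^ 2 := by rw [hb, div_pow]
  set J := ∫ t in Ioi b, Real.exp (-t ^ 2) with hJ
  have hJ0 : 0 ≤ J := setIntegral_nonneg measurableSet_Ioi fun t _ => (Real.exp_pos _).le
  have hscale : Amplifier.sel.scale A σr = 1 - Real.exp (-b ^ 2) + b * J := by
    have hpi : Real.sqrt Real.pi ≠ 0 := (Real.sqrt_pos.2 Real.pi_pos).ne'
    simp only [Amplifier.scale, erfc, hb2, ← hb, ← hJ]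
    rw [hb]
    field_simp
  have hE : b ^ 2 * Real.exp (-b ^ 2) ≤ 1 - Real.exp (-b ^ 2) := by
    have h1 := Real.add_one_le_exp (b ^ 2)
    have h2 : Real.exp (b ^ 2) * Real.exp (-b ^ 2) = 1 := by rw [← Real.exp_add]; simp
    have := mul_le_mul_of_nonneg_right h1 (Real.exp_pos (-b ^ 2)).le
    rw [h2] at this
    linarith
  have hE0 : 0 ≤ b ^ 2 * Real.exp (-b ^ 2) := by positivity
  have key : Amplifier.sel.scale A σr ^ 2 ≤ 1 - Real.exp (-b ^ 2) := by
    rw [hscale]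
    refine sq_le_of_forall_quadratic_nonneg fun s => ?_
    -- Write `E = exp (-b²)`. For `s ≥ 0` the integral bound leaves at least `(s - 1)² (1 - E - b²
    -- E)`, which `hE` makes nonnegative; for `s ≤ 0` every term is already nonnegative.
    rcases le_total 0 s with hs | hs
    · have h1 := two_mul_integral_exp_neg_sq_le hb0 hs
      have h2 := mul_le_mul_of_nonneg_left hE (sq_nonneg (s - 1))
      rw [← hJ] at h1
      nlinarith
    · have h1 : 0 ≤ -s * (1 - Real.exp (-b ^ 2) + b * J) :=
        mul_nonneg (neg_nonneg.2 hs) (add_nonneg (by linarith) (mul_nonneg hb0.le hJ0))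
      have h2 : 0 ≤ s ^ 2 * (1 - Real.exp (-b ^ 2)) := mul_nonneg (sq_nonneg _) (by linarith)
      linarith
  simp only [Amplifier.distortion, hb2]
  exact mul_nonneg (sq_nonneg _) (by linarith)

theorem distortion_twta_nonneg {A σr : ℝ} (hA : 0 < A) (hσ : 0 < σr) :
    0 ≤ Amplifier.twta.distortion A σr := by
  set a := A ^ 2 / σr ^ 2 with ha
  have ha0 : 0 < a := by positivity
  have hA4 : A ^ 4 / σr ^ 2 = a ^ 2 * σr ^ 2 := by rw [ha]; field_simp
  set Y := Real.exp a * ∫ t in Ioi a, Real.exp (-t) / t with hY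
  -- Here `1 - a Y` is the amplifier scale divided by `a`.
  have key : (1 - a * Y) ^ 2 ≤ (1 + a) * Y - 1 := by
    refine sq_le_of_forall_quadratic_nonneg fun s => ?_
    have h1 := mul_le_mul_of_nonneg_left (exp_neg_mul_le_integral_exp_neg_div ha0 s)
      (Real.exp_pos a).le
    have h2 : Real.exp a * Real.exp (-a) = 1 := by rw [← Real.exp_add]; simp
    rw [← mul_assoc, h2, one_mul, mul_left_comm, ← hY] at h1
    linarith
  have e1 : Real.exp a * expIntegralNeg a = -Y := by rw [expIntegralNeg, hY]; ring
  have : Amplifier.twta.distortion A σr =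
      a ^ 2 * σr ^ 2 * ((1 + a) * Y - 1 - (1 - a * Y) ^ 2) := by
    simp only [Amplifier.distortion, Amplifier.scale, ← ha, hA4, mul_assoc, e1]
    ring
  rw [this]
  exact mul_nonneg (by positivity) (by linarith)

end Distortion

namespace System

variable (S : System)

theorem distortion_nonneg : 0 ≤ S.amp.distortion S.Asat S.σr := by
  cases S.amp with
  | linear => exact le_rfl
  | sel => exact distortion_sel_nonneg S.Asat_pos S.σr_pos
  | twta => exact distortion_twta_nonneg S.Asat_pos S.σr_pos

theorem one_le_κ : 1 ≤ S.κ := by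
  have := S.distortion_nonneg
  unfold κ
  -- A vanishing denominator is harmless: the quotient is then `0`.
  have : 0 ≤ S.amp.distortion S.Asat S.σr /
    (S.amp.scale S.Asat S.σr ^ 2 * S.relayGain ^ 2 * S.σ₀ ^ 2) := by positivity
  linarith


/-! ### The first hop -/

/-- The joint law of the gains of the first hop. -/
noncomputable def radioLaw : Measure ((Fin S.N → ℂ) × (Fin S.N → ℂ)) :=
  (Measure.pi fun _ => complexGaussian S.v).prod (Measure.pi fun _ => complexGaussian S.v)

instance : IsProbabilityMeasure S.radioLaw := by
  unfold radioLaw; infer_instance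

/-- The position of the selected relay in the increasing arrangement. -/
def rankIndex : Fin S.N :=
  ⟨S.m - 1, by have := S.one_le_m; have := S.m_le_N; omega⟩

/-- The index of the selected relay, as a function of the outdated gains. -/
noncomputable def radioSelected (h : Fin S.N → ℂ) : Fin S.N :=
  Tuple.sort (fun i => S.P₁ * ‖h i‖ ^ 2 / S.σ₀ ^ 2) S.rankIndex

/-- The first-hop SNR, as a function of the gains of the first hop. -/
noncomputable def radioSNR (u : (Fin S.N → ℂ) × (Fin S.N → ℂ)) : ℝ :=
  S.P₁ * ‖(Real.sqrt S.ρ : ℂ) * u.1 (S.radioSelected u.1) +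
    (Real.sqrt (1 - S.ρ) : ℂ) * u.2 (S.radioSelected u.1)‖ ^ 2 / S.σ₀ ^ 2

theorem measurable_radioSelected : Measurable S.radioSelected :=
  measurable_to_countable' fun i => measurableSet_sort_eq
    (F := fun z => S.P₁ * ‖z‖ ^ 2 / S.σ₀ ^ 2) (by fun_prop) S.rankIndex i

theorem measurable_radioSNR : Measurable S.radioSNR := by
  -- Evaluation at a random index is measurable because the index set is countable.
  have h0 : Measurable fun p : (Fin S.N → ℂ) × Fin S.N => p.1 p.2 :=
    measurable_from_prod_countable_left fun i => measurable_pi_apply i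
  have h1 : Measurable fun u : (Fin S.N → ℂ) × (Fin S.N → ℂ) => u.1 (S.radioSelected u.1) :=
    h0.comp (measurable_fst.prodMk (S.measurable_radioSelected.comp measurable_fst))
  have h2 : Measurable fun u : (Fin S.N → ℂ) × (Fin S.N → ℂ) => u.2 (S.radioSelected u.1) :=
    h0.comp (measurable_snd.prodMk (S.measurable_radioSelected.comp measurable_fst))
  unfold radioSNR
  fun_prop

/-- The complementary distribution function of the first-hop SNR. -/
noncomputable def radioTail (x : ℝ) : ℝ :=
  S.m * (S.N.choose S.m : ℝ) * ∑ n ∈ Finset.range S.m,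
    ((S.m - 1).choose n : ℝ) * (-1) ^ n / ((S.N : ℝ) - S.m + n + 1) * Real.exp (-S.β n * x)

/-- The combined gain is complex Gaussian of variance `ρ v / l + (1 - ρ) v = (v / l) ((l - 1) (1 -
ρ) + 1)`. Open and closed half-lines are both allowed, to serve the outage and the distribution
function together. -/
theorem complexGaussian_mixture_real {T : Set ℝ} (hT : MeasurableSet T) {l : ℕ} (hl : 0 < l) {x : ℝ}
    (hx : 0 ≤ x) (hTx : T = Set.Ioi x ∨ T = Set.Ici x) :
    ((complexGaussian (S.v / l)).prod (complexGaussian S.v)).real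
      {p | S.P₁ * ‖(Real.sqrt S.ρ : ℂ) * p.1 + (Real.sqrt (1 - S.ρ) : ℂ) * p.2‖ ^ 2 / S.σ₀ ^ 2 ∈ T} =
      Real.exp (-(l / ((((l : ℝ) - 1) * (1 - S.ρ) + 1) * S.γbar₁)) * x) := by
  have hP := S.P₁_pos
  have hσ := S.σ₀_pos
  have hρ := S.ρ_nonneg
  have hρ1 : 0 ≤ 1 - S.ρ := sub_nonneg.2 S.ρ_le_one
  have hv : (0 : ℝ) < S.v := by exact_mod_cast S.v_pos
  have hl' : (1 : ℝ) ≤ l := by exact_mod_cast hl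
  have hl0 : (0 : ℝ) < l := by linarith
  have hden : 0 < ((l : ℝ) - 1) * (1 - S.ρ) + 1 := by
    have := mul_nonneg (sub_nonneg.2 hl') hρ1
    linarith
  set w : ℝ≥0 := ⟨S.v / l * (((l : ℝ) - 1) * (1 - S.ρ) + 1), by positivity⟩ with hw
  have hwv : (w : ℝ) = S.v / l * (((l : ℝ) - 1) * (1 - S.ρ) + 1) := rfl
  have hw0 : 0 < w := by rw [← NNReal.coe_pos, hwv]; positivity
  have hmap := map_complexGaussian_prod (Real.sqrt S.ρ) (Real.sqrt (1 - S.ρ)) (S.v / l) S.v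
    (w := w) (by
      rw [hwv, Real.sq_sqrt hρ, Real.sq_sqrt hρ1]
      push_cast
      field_simp
      ring)
  have hm : MeasurableSet {z : ℂ | S.P₁ * ‖z‖ ^ 2 / S.σ₀ ^ 2 ∈ T} :=
    (by fun_prop : Measurable fun z : ℂ => S.P₁ * ‖z‖ ^ 2 / S.σ₀ ^ 2) hT
  have h1 : ((complexGaussian (S.v / l)).prod (complexGaussian S.v)).real
      {p | S.P₁ * ‖(Real.sqrt S.ρ : ℂ) * p.1 + (Real.sqrt (1 - S.ρ) : ℂ) * p.2‖ ^ 2 / S.σ₀ ^ 2 ∈ T} =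
      (complexGaussian w).real {z | S.P₁ * ‖z‖ ^ 2 / S.σ₀ ^ 2 ∈ T} := by
    rw [← hmap, map_measureReal_apply (by fun_prop) hm]
    rfl
  set a := Real.sqrt (x * S.σ₀ ^ 2 / S.P₁) with ha
  have ha0 : 0 ≤ a := Real.sqrt_nonneg _
  have ha2 : a ^ 2 = x * S.σ₀ ^ 2 / S.P₁ := Real.sq_sqrt (by positivity)
  have hval : Real.exp (-(a ^ 2 / w)) =
      Real.exp (-(l / ((((l : ℝ) - 1) * (1 - S.ρ) + 1) * S.γbar₁)) * x) := by
    congr 1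
    rw [ha2, hwv, γbar₁]
    field_simp
  have hxa : x = S.P₁ * a ^ 2 / S.σ₀ ^ 2 := by rw [ha2]; field_simp
  rw [h1, ← hval]
  rcases hTx with rfl | rfl
  · rw [← complexGaussian_lt_norm hw0 ha0]
    congr 1
    ext z
    simp only [Set.mem_ofPred_eq, Set.mem_Ioi]
    rw [hxa, div_lt_div_iff_of_pos_right (by positivity), mul_lt_mul_iff_right₀ hP,
      sq_lt_sq₀ ha0 (norm_nonneg z)]
  · rw [← complexGaussian_le_norm hw0 ha0]
    congr 1
    ext z
    simp only [Set.mem_ofPred_eq, Set.mem_Ici]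
    rw [hxa, div_le_div_iff_of_pos_right (by positivity), mul_le_mul_iff_right₀ hP,
      sq_le_sq₀ ha0 (norm_nonneg z)]

theorem radioLaw_real {T : Set ℝ} (hT : MeasurableSet T) {x : ℝ}
    (hx : 0 ≤ x) (hTx : T = Set.Ioi x ∨ T = Set.Ici x) :
    S.radioLaw.real (S.radioSNR ⁻¹' T) = S.radioTail x := by
  have hP := S.P₁_pos
  have hσ := S.σ₀_pos
  have hm1 := S.one_le_m
  have hmN := S.m_le_N
  have hF : ∀ z w : ℂ, S.P₁ * ‖z‖ ^ 2 / S.σ₀ ^ 2 < S.P₁ * ‖w‖ ^ 2 / S.σ₀ ^ 2 ↔ ‖z‖ < ‖w‖ := by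
    intro z w
    rw [div_lt_div_iff_of_pos_right (by positivity), mul_lt_mul_iff_right₀ hP,
      sq_lt_sq₀ (norm_nonneg z) (norm_nonneg w)]
  have hB : MeasurableSet {p : ℂ × ℂ | S.P₁ * ‖(Real.sqrt S.ρ : ℂ) * p.1 +
      (Real.sqrt (1 - S.ρ) : ℂ) * p.2‖ ^ 2 / S.σ₀ ^ 2 ∈ T} :=
    (by fun_prop : Measurable fun p : ℂ × ℂ => S.P₁ * ‖(Real.sqrt S.ρ : ℂ) * p.1 +
      (Real.sqrt (1 - S.ρ) : ℂ) * p.2‖ ^ 2 / S.σ₀ ^ 2) hT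
  have h := pair_sort_law_real S.v_pos (F := fun z => S.P₁ * ‖z‖ ^ 2 / S.σ₀ ^ 2) (by fun_prop) hF
    S.rankIndex hB
  have hj : (S.rankIndex : ℕ) = S.m - 1 := rfl
  have hj1 : S.m - 1 + 1 = S.m := by omega
  -- This converts the symmetric count `N C(N-1, m-1)` into the coefficient of the closed form.
  have hchoose : (S.N : ℝ) * ((S.N - 1).choose (S.m - 1) : ℝ) = S.m * (S.N.choose S.m : ℝ) := by
    have := Nat.add_one_mul_choose_eq (S.N - 1) (S.m - 1)
    rw [hj1, show S.N - 1 + 1 = S.N by omega] at this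
    rw [mul_comm (S.m : ℝ)]
    exact_mod_cast this
  refine Eq.trans ?_ (h.trans ?_)
  · rfl
  · rw [hj, hj1, hchoose, radioTail]
    congr 1
    refine Finset.sum_congr rfl fun n _ => ?_
    have hl : 0 < S.N - (S.m - 1) + n := by omega
    have hcast : ((S.N - (S.m - 1) + n : ℕ) : ℝ) = (S.N : ℝ) - S.m + n + 1 := by
      rw [show S.N - (S.m - 1) + n = S.N - S.m + n + 1 by omega]
      push_cast [Nat.cast_sub hmN]
      ring
    rw [S.complexGaussian_mixture_real hT hl hx hTx, hcast, β]
    rw [show (S.N : ℝ) - S.m + n + 1 - 1 = (S.N : ℝ) - S.m + n by ring]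
    ring

/-! ### The end-to-end ratio -/

theorem law_eq : S.law = (S.radioLaw.prod S.opticalLaw).map MeasurableEquiv.prodAssoc := by
  rw [radioLaw, Measure.prodAssoc_prod]
  rfl

/-- Only the sign of the mean matters below, so the integrability of `γ₁` is not needed. -/
theorem meanγ₁_nonneg : 0 ≤ S.meanγ₁ := by
  have := S.P₁_pos
  refine integral_nonneg fun x => ?_
  unfold γ₁
  positivity

theorem c_pos : 0 < S.c := by
  have := S.meanγ₁_nonneg
  have := S.one_le_κ
  unfold c
  linarith

theorem β_pos {n : ℕ} : 0 < S.β n := by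
  have hN : (S.m : ℝ) ≤ S.N := by exact_mod_cast S.m_le_N
  have h1 : 0 ≤ (S.N : ℝ) - S.m + n := by
    have : (0 : ℝ) ≤ n := n.cast_nonneg
    linarith
  have h2 := mul_nonneg h1 (sub_nonneg.2 S.ρ_le_one)
  have hP := S.P₁_pos
  have hσ := S.σ₀_pos
  have hv : (0 : ℝ) < S.v := by exact_mod_cast S.v_pos
  have h3 : 0 < S.γbar₁ := by unfold γbar₁; positivity
  unfold β
  exact div_pos (by linarith) (mul_pos (by linarith) h3)

theorem meanGain₂_eq : S.meanGain₂ = ∫ y, S.opticalGain y ∂S.opticalLaw := by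
  rw [meanGain₂, S.law_eq, integral_map_equiv]
  exact integral_fun_snd (μ := S.radioLaw) (f := S.opticalGain) |>.trans (by simp)

theorem meanGain₂_pos : 0 < S.meanGain₂ := by
  rw [S.meanGain₂_eq]; exact S.integral_opticalGain_pos

theorem integrable_exp_neg_div {y : ℝ} (hy : 0 ≤ y) :
    Integrable (fun x => Real.exp (-(y / S.opticalSNR x))) S.opticalLaw := by
  have := S.measurable_opticalSNR
  refine Integrable.of_bound (by fun_prop : Measurable fun x =>
    Real.exp (-(y / S.opticalSNR x))).aestronglyMeasurable 1 ?_
  filter_upwards [S.opticalSNR_ae_pos] with x hx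
  rw [Real.norm_of_nonneg (Real.exp_pos _).le, Real.exp_le_one_iff, neg_nonpos]
  positivity

/-- Fubini with the optical variables fixed. The family `T` carries the half-line at `t` over to one
of the same type at the first-hop threshold. -/
theorem law_real_sndr {t : ℝ} (ht : 0 < t) {T : ℝ → Set ℝ} (hT : ∀ x, MeasurableSet (T x))
    (hTx : (∀ x, T x = Set.Ioi x) ∨ ∀ x, T x = Set.Ici x) :
    S.law.real {x | S.sndr x ∈ T t} = S.m * (S.N.choose S.m : ℝ) * ∑ n ∈ Finset.range S.m,
      ((S.m - 1).choose n : ℝ) * (-1) ^ n / ((S.N : ℝ) - S.m + n + 1) *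
        (Real.exp (-S.β n * S.κ * t) *
          ∫ y, Real.exp (-(S.β n * t * S.c / S.opticalSNR y)) ∂S.opticalLaw) := by
  have hκ := S.one_le_κ
  have hc := S.c_pos
  have h1 := S.measurable_radioSNR
  have h2 := S.measurable_opticalSNR
  set f : ((Fin S.N → ℂ) × (Fin S.N → ℂ)) × (ℝ × ℝ × ℝ) → ℝ := fun z =>
    S.radioSNR z.1 * S.opticalSNR z.2 / (S.κ * S.opticalSNR z.2 + S.meanγ₁ + S.κ) with hf
  have hfm : Measurable f := by fun_prop
  have hpre : S.law.real {x | S.sndr x ∈ T t} = (S.radioLaw.prod S.opticalLaw).real (f ⁻¹' T t) := by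
    rw [S.law_eq, Measure.real, MeasurableEquiv.map_apply]
    rfl
  have hswap : (S.radioLaw.prod S.opticalLaw).real (f ⁻¹' T t) =
      ∫ y, S.radioLaw.real ((fun u => (u, y)) ⁻¹' (f ⁻¹' T t)) ∂S.opticalLaw := by
    rw [Measure.real, Measure.prod_apply_symm (hfm (hT t)), ← integral_toReal
      (measurable_measure_prodMk_right (hfm (hT t))).aemeasurable
      (Filter.Eventually.of_forall fun _ => measure_lt_top _ _)]
    rfl
  have hae : ∀ᵐ y ∂S.opticalLaw, S.radioLaw.real ((fun u => (u, y)) ⁻¹' (f ⁻¹' T t)) =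
      S.m * (S.N.choose S.m : ℝ) * ∑ n ∈ Finset.range S.m,
      ((S.m - 1).choose n : ℝ) * (-1) ^ n / ((S.N : ℝ) - S.m + n + 1) *
        (Real.exp (-S.β n * S.κ * t) * Real.exp (-(S.β n * t * S.c / S.opticalSNR y))) := by
    filter_upwards [S.opticalSNR_ae_pos] with y hy
    -- The value of `γ₁` at which the end-to-end ratio equals `t`. Its part `t κ` gives the
    -- exponential factor, its part `t c / γ₂` the average over the optical hop.
    set x := t * (S.κ + S.c / S.opticalSNR y) with hx
    have hx0 : 0 ≤ x := by positivity
    have hden : 0 < S.κ * S.opticalSNR y + S.meanγ₁ + S.κ := by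
      have := mul_pos (lt_of_lt_of_le one_pos hκ) hy
      have := S.meanγ₁_nonneg
      linarith
    have hxd : x * S.opticalSNR y = t * (S.κ * S.opticalSNR y + S.meanγ₁ + S.κ) := by
      rw [hx, c]; field_simp; ring
    have hset : (fun u => (u, y)) ⁻¹' (f ⁻¹' T t) = S.radioSNR ⁻¹' T x := by
      ext u
      simp only [Set.mem_preimage, hf]
      rcases hTx with h | h
      · rw [h, h, Set.mem_Ioi, Set.mem_Ioi, lt_div_iff₀ hden, ← hxd, mul_lt_mul_iff_left₀ hy]
      · rw [h, h, Set.mem_Ici, Set.mem_Ici, le_div_iff₀ hden, ← hxd, mul_le_mul_iff_left₀ hy]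
    rw [hset, S.radioLaw_real (hT x) hx0 (hTx.imp (fun h => h x) fun h => h x), radioTail]
    congr 1
    refine Finset.sum_congr rfl fun n _ => ?_
    rw [← Real.exp_add]
    congr 2
    rw [hx]; ring
  rw [hpre, hswap, integral_congr_ae hae, integral_const_mul, integral_finsetSum]
  · simp_rw [integral_const_mul]
  · intro n _
    exact ((S.integrable_exp_neg_div (by have := S.β_pos (n := n); positivity)).const_mul _).const_mul _

theorem measurable_sndr : Measurable S.sndr := by
  have h0 := S.measurable_radioSNR
  have h1 : Measurable S.γ₁ := by
    have : S.γ₁ = S.radioSNR ∘ fun x => (x.1, x.2.1) := rfl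
    rw [this]
    exact h0.comp (by fun_prop)
  have h2 : Measurable S.γ₂ := by
    have : S.γ₂ = S.opticalSNR ∘ fun x => x.2.2 := rfl
    rw [this]
    exact S.measurable_opticalSNR.comp (by fun_prop)
  unfold sndr
  fun_prop

instance : IsProbabilityMeasure S.law := by
  rw [S.law_eq]
  exact Measure.isProbabilityMeasure_map MeasurableEquiv.prodAssoc.measurable.aemeasurable

theorem outage_eq_one_sub (t : ℝ) : S.outage t = 1 - S.law.real {x | S.sndr x ∈ Set.Ici t} := by
  refine Eq.trans ?_
    (probReal_compl_eq_one_sub (μ := S.law) (S.measurable_sndr (measurableSet_Ici (a := t))))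
  rw [outage]
  congr 1
  ext x
  simp

theorem sndrCDF_eq_one_sub (t : ℝ) : S.sndrCDF t = 1 - S.law.real {x | S.sndr x ∈ Set.Ioi t} := by
  refine Eq.trans ?_
    (probReal_compl_eq_one_sub (μ := S.law) (S.measurable_sndr (measurableSet_Ioi (a := t))))
  rw [sndrCDF]
  congr 1
  ext x
  simp

end System

end FixedGainRelay

theorem mainTheorem1 (S : FixedGainRelay.System) (p q k : ℕ) (hp : 0 < p) (hq : 0 < q)
    (hpq : (p : ℝ) / q = S.α₁ / S.α₂) (hk : (k : ℝ) = S.α₂ * p)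
    (t : ℝ) (ht : 0 < t) :
    S.outage t = S.sndrCDF t ∧
    (S.outage t : ℂ) = 1 - (S.prefactor p q k : ℂ) *
      ∑ n ∈ Finset.range S.m,
        ((S.m - 1).choose n : ℂ) * ((-1 : ℂ) ^ n / ((S.N : ℂ) - S.m + n + 1)) *
          (Real.exp (-S.β n * S.κ * t) : ℂ) * S.meijerTerm p q k n t := by
  have hIci := S.law_real_sndr ht (T := Set.Ici) (fun _ => measurableSet_Ici) (Or.inr fun _ => rfl)
  have hIoi := S.law_real_sndr ht (T := Set.Ioi) (fun _ => measurableSet_Ioi) (Or.inl fun _ => rfl)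
  -- The tails over the open and closed half-lines have the same closed form, so the ratio has no
  -- atom at `t`.
  refine ⟨by rw [S.outage_eq_one_sub, S.sndrCDF_eq_one_sub, hIci, hIoi], ?_⟩
  have hk0 : 0 < k := by
    have hp' : (0 : ℝ) < p := by exact_mod_cast hp
    have : (0 : ℝ) < k := hk ▸ mul_pos S.α₂_pos hp'
    exact_mod_cast this
  have hfac := congrArg (fun x : ℝ => (x : ℂ)) (S.prefactor_mul_meijerFactor hp hq hk0 hk)
  rw [S.outage_eq_one_sub, hIci]
  push_cast at hfac ⊢
  -- The coefficient `m C(N, m)` is split as `prefactor` times `meijerFactor`; the second factor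
  -- turns each average into a Meijer function.
  rw [← hfac, Finset.mul_sum, Finset.mul_sum]
  congr 1
  refine Finset.sum_congr rfl fun n _ => ?_
  rw [FixedGainRelay.System.meijerTerm, S.meijerG_eq_integral_exp hp hq hk0 hpq hk S.meanGain₂_pos
    (mul_pos (mul_pos S.β_pos ht) S.c_pos)]
  ring
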